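/- **Theorem (OFUL for RL with Trajectory Feedback and Known Model).** *Setting.* Let $\mathcal S,\mathcal A$ be finite sets with $S=|\mathcal S|$, $A=|\mathcal A|$, let $H\ge 1$ be the horizon, let $P(s'\mid s,a)$ be a transition kernel on $\mathcal S$, and for each $(s,a)$ let the reward $R(s,a)\in[0,1]$ be random with mean $r(s,a)$. A deterministic policy is a map $\pi:\mathcal S\times[H]\to\mathcal A$. Executing $\pi$ from the initial state $s_1$ generates $a_h=\pi(s_h,h)$ and $s_{h+1}\sim P(\cdot\mid s_h,a_h)$; given the visited state-action pairs, the rewards $R_1,\dots,R_H$ received at the $H$ time steps are independent, $R_h$ having the law of $R(s_h,a_h)$. Let $V_1^\pi(s_1)=\mathbb E\big[\sum_{h=1}^H r(s_h,a_h)\big]$, $V_1^*(s_1)=\max_\pi V_1^\pi(s_1)$, and let $d_\pi\in\mathbb R^{SA}$, $d_\pi(s,a)=\sum_{h=1}^H\Pr(s_h=s,a_h=a)$ (it depends on the initial state of the episode). *Interaction.* In episodes $k=1,2,\dots$ the initial state $s_1^k$ is arbitrary (it may depend on the past), the agent chooses a deterministic policy $\pi_k$ from the past and $s_1^k$, and,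 given the past, the policy $\pi_k$ is executed from $s_1^k$. The agent observes the visited pairs $(s_h^k,a_h^k)_{h=1}^H$ and only the cumulative reward $\hat V_k=\sum_{h=1}^H R_h^k$. The past may contain additional randomness, and the initial states and the choice between maximizers below may depend on it. The regret is $\mathrm R(K)=\sum_{k=1}^K\big(V_1^*(s_1^k)-V_1^{\pi_k}(s_1^k)\big)$. *Algorithm.* The agent knows $P$ and $\delta$. With $\lambda=H$, $\hat d_k(s,a)=\sum_{h=1}^H\mathbf 1\{s_h^k=s,a_h^k=a\}$, let $$A_k=\lambda I_{SA}+\sum_{l=1}^k\hat d_l\hat d_l^{\,T},\qquad Y_k=\sum_{l=1}^k\hat V_l\,\hat d_l,\qquad \hat r_k=A_k^{-1}Y_k,$$ $$l_k=\sqrt{\tfrac14 SAH\log\frac{1+kH^2/\lambda}{\delta/10}}+\sqrt{\lambda SA}.$$ In each episode $k$ it plays some deterministic policy $$\pi_k\in\arg\max_\pi\Big(d_\pi^T\hat r_{k-1}+l_{k-1}\sqrt{d_\pi^TA_{k-1}^{-1}d_\pi}\Big),$$ with $d_\pi$ computed from $P$ and the initial state $s_1^k$. *Claim.* There is an absolute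 constant $C>0$ such that, for all such MDPs and every $\delta\in(0,1)$, with probability greater than $1-\delta$, simultaneously for all integers $K\ge1$ with $KH/\delta\ge2$ (that is, for all $K\ge 1$, except $K=1$ in the case $H=1$, $\delta>1/2$), $$\mathrm R(K)\le C\,SAH\sqrt K\,\log\frac{KH}{\delta}.$$ -/

import Mathlib

open MeasureTheory ProbabilityTheory Matrix

noncomputable section

/-- A finite MDP with time-independent dynamics: transition probabilities `P(· ∣ s, a)` and, for
each state-action pair, the law of the random immediate reward `R(s, a) ∈ [0, 1]`. The horizon `H`
is a separate parameter. -/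
structure FiniteMDP (S A : Type*) where
  /-- the transition kernel -/
  trans : S → A → PMF S
  /-- the law of the random reward of a state-action pair, a probability measure on `[0, 1]` -/
  rewardLaw : S → A → ProbabilityMeasure unitInterval

/-- Deterministic (time-dependent) policies `π : S × [H] → A`. -/
abbrev DetPolicy (S A : Type*) (H : ℕ) : Type _ := S → Fin H → A

/-- What happens in one episode: at each of the `H` time steps, the visited state-action pair
and the reward that is received there. -/
abbrev Episode (S A : Type*) (H : ℕ) : Type _ := Fin H → (S × A) × unitInterval

namespace FiniteMDP

variable {S A : Type*} [Fintype S] [Fintype A] [DecidableEq S] [DecidableEq A]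
  [MeasurableSpace S] [MeasurableSpace A] {H : ℕ}

/-- The mean reward `r(s, a) = E[R(s, a)]`, as a vector indexed by state-action pairs. -/
def meanReward (M : FiniteMDP S A) (z : S × A) : ℝ :=
  ∫ x : unitInterval, (x : ℝ) ∂(M.rewardLaw z.1 z.2 : Measure unitInterval)

/-- The probability that the states visited in an episode are `x`, when policy `π` is executed from
the initial state `s₁`: the product over the time steps `h` of the probability of `x h`, given the
state at the preceding time step and the action that `π` takes there. -/
def pathProb (M : FiniteMDP S A) (π : DetPolicy S A H) (s₁ : S) (x : Fin H → S) : ENNReal :=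
  ∏ h : Fin H,
    if h.val = 0 then (if x h = s₁ then 1 else 0)
    else
      let g : Fin H := ⟨h.val - 1, lt_of_le_of_lt (Nat.sub_le _ _) h.isLt⟩
      M.trans (x g) (π (x g) g) (x h)

/-- The law of an episode in which policy `π` is executed from the initial state `s₁`: the visited
states form a Markov path; the action at time `h` is `π (x h) h`; given the visited state-action
pairs, the rewards are independent over the time steps, each with the reward law of its pair. -/
def episodeLaw (M : FiniteMDP S A) (π : DetPolicy S A H) (s₁ : S) : Measure (Episode S A H) :=
  ∑ x : Fin H → S, M.pathProb π s₁ x •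
    Measure.pi fun h : Fin H =>
      (Measure.dirac (x h, π (x h) h)).prod
        (M.rewardLaw (x h) (π (x h) h) : Measure unitInterval)

/-- The occupancy measure `q_h^π(s, a) = Pr(s_h = s, a_h = a ∣ s_1 = s₁, π)`. -/
def occupancy (M : FiniteMDP S A) (π : DetPolicy S A H) (s₁ : S) (h : Fin H) (z : S × A) : ℝ :=
  (M.episodeLaw π s₁).real {τ | (τ h).1 = z}

/-- The average occupancy measure `d_π(s, a) = ∑_h q_h^π(s, a)`, for the initial state `s₁`. -/
def avgOccupancy (M : FiniteMDP S A) (π : DetPolicy S A H) (s₁ : S) (z : S × A) : ℝ :=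
  ∑ h : Fin H, M.occupancy π s₁ h z

/-- The value `V_1^π(s₁) = E[∑_h r(s_h, a_h) ∣ s_1 = s₁, π]`. -/
def value (M : FiniteMDP S A) (π : DetPolicy S A H) (s₁ : S) : ℝ :=
  ∫ τ, ∑ h : Fin H, M.meanReward (τ h).1 ∂(M.episodeLaw π s₁)

/-- The optimal value `V_1^*(s₁) = max_π V_1^π(s₁)`, over the finitely many deterministic policies
of horizon `H`. -/
def optValue (M : FiniteMDP S A) (H : ℕ) (s₁ : S) : ℝ :=
  ⨆ π : DetPolicy S A H, M.value π s₁

end FiniteMDP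

/-- `‖x‖_M = √(xᵀ M x)`. -/
def matNorm {m : Type*} [Fintype m] (M : Matrix m m ℝ) (x : m → ℝ) : ℝ :=
  Real.sqrt (x ⬝ᵥ (M *ᵥ x))

section Estimation

variable {S A : Type*} [Fintype S] [Fintype A] [DecidableEq S] [DecidableEq A] {H : ℕ}

/-- The cumulative reward `V̂` of an episode (the trajectory feedback). -/
def cumReward (τ : Episode S A H) : ℝ := ∑ h : Fin H, ((τ h).2 : ℝ)

/-- The empirical state-action frequency `d̂(s, a) = ∑_h 1{s = s_h, a = a_h}` of an episode. -/
def visitCount (τ : Episode S A H) (z : S × A) : ℝ := ∑ h : Fin H, if (τ h).1 = z then 1 else 0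

/-- `A_k = λ I + ∑ d̂ d̂ᵀ`, over the first `k` episodes `τ 0, …, τ (k - 1)`. -/
def gramMatrix (lam : ℝ) (τ : ℕ → Episode S A H) (k : ℕ) : Matrix (S × A) (S × A) ℝ :=
  lam • (1 : Matrix (S × A) (S × A) ℝ) +
    ∑ l ∈ Finset.range k, vecMulVec (visitCount (τ l)) (visitCount (τ l))

/-- `Y_k = ∑ V̂ d̂`, over the first `k` episodes. -/
def responseVec (τ : ℕ → Episode S A H) (k : ℕ) : S × A → ℝ :=
  ∑ l ∈ Finset.range k, cumReward (τ l) • visitCount (τ l)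

/-- The regularized least-squares estimator `r̂_k = A_k⁻¹ Y_k` of the mean reward. -/
def lsEstimator (lam : ℝ) (τ : ℕ → Episode S A H) (k : ℕ) : S × A → ℝ :=
  (gramMatrix lam τ k)⁻¹ *ᵥ responseVec τ k

/-- The confidence width `l_k`. -/
def confWidth (S A : Type*) [Fintype S] [Fintype A] (H : ℕ) (lam δ : ℝ) (k : ℕ) : ℝ :=
  Real.sqrt ((1 / 4) * (Fintype.card S : ℝ) * (Fintype.card A : ℝ) * (H : ℝ) *
      Real.log ((1 + (k : ℝ) * (H : ℝ) ^ 2 / lam) / (δ / 10))) +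
    Real.sqrt (lam * (Fintype.card S : ℝ) * (Fintype.card A : ℝ))

end Estimation

section Interaction

variable {S A : Type*} [Fintype S] [Fintype A] [DecidableEq S] [DecidableEq A]
  [MeasurableSpace S] [MeasurableSpace A] {H : ℕ}

/-- An agent interacts with the MDP `M` in episodes `0, 1, 2, …` of horizon `H`. The σ-algebra
`F k` contains everything that happened in the first `k` episodes, and the initial state of the next
one. The initial state `s₁ k` is arbitrary (possibly adaptive), the agent picks the policy `π k`
from the past, and, conditionally on `F k`, the outcome `τ k` of the episode is distributed as
the episode generated by executing `π k` in `M` from `s₁ k`. -/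
structure IsInteraction {Ω : Type*} [mΩ : MeasurableSpace Ω] (μ : Measure Ω)
    (F : Filtration ℕ mΩ) (M : FiniteMDP S A) (s₁ : ℕ → Ω → S)
    (π : ℕ → Ω → DetPolicy S A H) (τ : ℕ → Ω → Episode S A H) : Prop where
  measurable_init : ∀ k, Measurable[F k] (s₁ k)
  measurable_policy : ∀ k, Measurable[F k] (π k)
  measurable_episode : ∀ k, Measurable[F (k + 1)] (τ k)
  condLaw : ∀ k, ∀ B : Set (Episode S A H), MeasurableSet B →
    μ[(τ k ⁻¹' B).indicator (fun _ => (1 : ℝ)) | F k]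
      =ᵐ[μ] fun ω => (M.episodeLaw (π k ω) (s₁ k ω)).real B

/-- The objective `d_πᵀ r̂_k + l_k ‖d_π‖_{A_k⁻¹}` of the optimistic algorithm after `k` episodes with
outcomes `τ 0, …, τ (k - 1)`, when the next episode starts at `s₁`. -/
def ofulObjective (M : FiniteMDP S A) (lam δ : ℝ) (τ : ℕ → Episode S A H) (k : ℕ) (s₁ : S)
    (π : DetPolicy S A H) : ℝ :=
  M.avgOccupancy π s₁ ⬝ᵥ lsEstimator lam τ k +
    confWidth S A H lam δ k * matNorm (gramMatrix lam τ k)⁻¹ (M.avgOccupancy π s₁)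

/-- The agent runs the optimistic (OFUL) algorithm with known transition model, confidence
parameter `δ` and regularization `λ = H`: in each episode it plays a deterministic policy that
maximizes the objective, ties being broken in any way. -/
def IsOFUL {Ω : Type*} (M : FiniteMDP S A) (δ : ℝ) (s₁ : ℕ → Ω → S)
    (π : ℕ → Ω → DetPolicy S A H) (τ : ℕ → Ω → Episode S A H) : Prop :=
  ∀ k ω, ∀ π' : DetPolicy S A H,
    ofulObjective M (H : ℝ) δ (fun l => τ l ω) k (s₁ k ω) π' ≤
      ofulObjective M (H : ℝ) δ (fun l => τ l ω) k (s₁ k ω) (π k ω)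

/-- The regret `∑ (V_1^*(s₁) - V_1^π(s₁))` over the first `K` episodes, where `s₁ k` is the initial
state and `π k` the policy of an episode. -/
def regret (M : FiniteMDP S A) (s₁ : ℕ → S) (π : ℕ → DetPolicy S A H) (K : ℕ) : ℝ :=
  ∑ k ∈ Finset.range K, (M.optValue H (s₁ k) - M.value (π k) (s₁ k))

end Interaction

end

/-!
The trajectory feedback of an episode is a noisy linear observation: `V̂ = ⟨d̂, r⟩ + η`, where `d̂`
counts the visits to the state-action pairs. Given the visited pairs, the noise `η` is a sum of `H`
independent centred variables of range at most one, hence sub-Gaussian with variance proxy `H / 4`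
(`FiniteMDP.lintegral_exp_noise_rewardsLaw_le`). The value of a policy is linear in `r` as well,
with coefficient vector `d_π = E d̂` (`FiniteMDP.value_eq_dotProduct`). The regret is controlled on
the intersection of two events, whose complements have probability at most `δ / 10` each by Ville's
inequality (`IsInteraction.mul_measure_exists_le_prod`).

*Confidence ellipsoid.* Put `S = ∑ η d̂`. The process `exp (2 ‖S‖² / H) √(det (H I) / det A)`, with
the norm of `A⁻¹`, is a supermartingale. Instead of integrating over a multivariate Gaussian prior,
this is verified one step at a time: by the Sherman–Morrison formula and the matrix determinant
lemma, the growth factor `selfNormalizedFactor` of a step depends on two scalars only, and its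
conditional mean is at most one by a mixture over a one-dimensional Gaussian
(`lintegral_exp_selfNormalized_le`). Since the determinant grows polynomially
(`prod_one_add_width_le`), `⟨d, r̂ - r⟩` is at most the confidence width times `‖d‖` for all `d`
(`abs_dotProduct_lsEstimator_sub_le`). Consequently, by optimism, the regret of an episode is at
most `2 l ‖d_π‖` (`optValue_sub_value_le`).

*Expected versus observed widths.* The elliptical potential bounds `∑ ‖d̂‖²` (`sum_width_div_le`),
whereas the regret involves `‖d_π‖ = ‖E d̂‖`. As `‖d̂‖² / H` has values in `[0, 1]`, Jensen's
inequality and `exp (-y) ≤ 1 - y / 2` make `exp (∑ (‖d_π‖² / (2 H) - ‖d̂‖² / H))` a supermartingale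
(`FiniteMDP.lintegral_exp_width_le`). This multiplicative comparison holds for all `K` at once and
costs only a constant and an additive `log (10 / δ)`. The Cauchy–Schwarz inequality then bounds
`∑ ‖d_π‖`, and the constant `30` results.

If there is a single state-action pair, there is only one policy and the regret vanishes; otherwise
`2 ≤ SA`, which is what the confidence width requires.
-/

/-! ### Rank-one updates, Gram matrices and the elliptical potential -/

section LinearAlgebra

variable {n : Type*} [Fintype n]

lemma Matrix.PosDef.posDef_add_vecMulVec {A : Matrix n n ℝ} (hA : A.PosDef) (d : n → ℝ) :
    (A + vecMulVec d d).PosDef :=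
  hA.add_posSemidef (by simpa using posSemidef_vecMulVec_self_star d)

lemma Matrix.IsHermitian.dotProduct_mulVec_comm {B : Matrix n n ℝ} (hB : B.IsHermitian)
    (x y : n → ℝ) : x ⬝ᵥ (B *ᵥ y) = y ⬝ᵥ (B *ᵥ x) := by
  have hT : Bᵀ = B := by simpa [IsHermitian, conjTranspose_eq_transpose_of_trivial] using hB
  rw [dotProduct_mulVec, ← mulVec_transpose, hT, dotProduct_comm]

lemma Matrix.PosSemidef.dotProduct_mulVec_self_nonneg {B : Matrix n n ℝ} (hB : B.PosSemidef)
    (x : n → ℝ) : 0 ≤ x ⬝ᵥ (B *ᵥ x) := by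
  simpa using hB.dotProduct_mulVec_nonneg x

/-- Cauchy–Schwarz for the bilinear form of a positive semidefinite matrix. -/
lemma Matrix.PosSemidef.abs_dotProduct_mulVec_le {B : Matrix n n ℝ} (hB : B.PosSemidef)
    (x y : n → ℝ) : |x ⬝ᵥ (B *ᵥ y)| ≤ matNorm B x * matNorm B y := by
  rw [matNorm, matNorm, ← Real.sqrt_mul (hB.dotProduct_mulVec_self_nonneg x)]
  apply Real.abs_le_sqrt
  have h : ∀ t : ℝ, 0 ≤ (y ⬝ᵥ (B *ᵥ y)) * (t * t) + (2 * (x ⬝ᵥ (B *ᵥ y))) * t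
      + x ⬝ᵥ (B *ᵥ x) := by
    intro t
    have h1 := hB.dotProduct_mulVec_self_nonneg (x + t • y)
    have h2 := hB.isHermitian.dotProduct_mulVec_comm y x
    simp only [mulVec_add, mulVec_smul, add_dotProduct, dotProduct_add, smul_dotProduct,
      dotProduct_smul, smul_eq_mul, h2] at h1
    linarith
  have := discrim_le_zero h
  rw [discrim] at this
  linarith

lemma Matrix.PosSemidef.matNorm_sq {B : Matrix n n ℝ} (hB : B.PosSemidef) (x : n → ℝ) :
    matNorm B x ^ 2 = x ⬝ᵥ (B *ᵥ x) :=
  Real.sq_sqrt (hB.dotProduct_mulVec_self_nonneg x)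

lemma matNorm_nonneg (B : Matrix n n ℝ) (x : n → ℝ) : 0 ≤ matNorm B x := Real.sqrt_nonneg _

variable [DecidableEq n]

/-- The Sherman–Morrison formula for a symmetric rank-one update. -/
lemma Matrix.PosDef.inv_add_vecMulVec {A : Matrix n n ℝ} (hA : A.PosDef) (d : n → ℝ) :
    (A + vecMulVec d d)⁻¹ =
      A⁻¹ - (1 + d ⬝ᵥ (A⁻¹ *ᵥ d))⁻¹ • vecMulVec (A⁻¹ *ᵥ d) (A⁻¹ *ᵥ d) := by
  have hw : 0 < 1 + d ⬝ᵥ (A⁻¹ *ᵥ d) := by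
    linarith [hA.inv.posSemidef.dotProduct_mulVec_self_nonneg d]
  have hdet : IsUnit A.det := A.isUnit_iff_isUnit_det.1 hA.isUnit
  have hT : A⁻¹ᵀ = A⁻¹ := by
    simpa [IsHermitian, conjTranspose_eq_transpose_of_trivial] using hA.inv.isHermitian
  apply inv_eq_right_inv
  have e1 : vecMulVec d d * A⁻¹ = vecMulVec d (A⁻¹ *ᵥ d) := by
    rw [vecMulVec_mul, ← mulVec_transpose, hT]
  have e2 : A * vecMulVec (A⁻¹ *ᵥ d) (A⁻¹ *ᵥ d) = vecMulVec d (A⁻¹ *ᵥ d) := by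
    rw [mul_vecMulVec, mulVec_mulVec, mul_nonsing_inv _ hdet, one_mulVec]
  have e3 : vecMulVec d d * vecMulVec (A⁻¹ *ᵥ d) (A⁻¹ *ᵥ d) =
      (d ⬝ᵥ (A⁻¹ *ᵥ d)) • vecMulVec d (A⁻¹ *ᵥ d) := by
    rw [vecMulVec_mul_vecMulVec, vecMulVec_smul]
  rw [add_mul, mul_sub, mul_sub, mul_nonsing_inv _ hdet, e1, mul_smul_comm, mul_smul_comm, e2, e3,
    smul_smul]
  have : (1 + d ⬝ᵥ (A⁻¹ *ᵥ d))⁻¹ * (d ⬝ᵥ (A⁻¹ *ᵥ d)) = 1 - (1 + d ⬝ᵥ (A⁻¹ *ᵥ d))⁻¹ := by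
    field_simp; ring
  rw [this, sub_smul, one_smul]
  abel

/-- The effect of one more observation `η • d` on the self-normalized sum `S` in the squared norm
given by the inverse Gram matrix. -/
lemma Matrix.PosDef.quadForm_inv_add_vecMulVec {A : Matrix n n ℝ} (hA : A.PosDef)
    (d S : n → ℝ) (η : ℝ) :
    (S + η • d) ⬝ᵥ ((A + vecMulVec d d)⁻¹ *ᵥ (S + η • d)) =
      S ⬝ᵥ (A⁻¹ *ᵥ S) +
        (2 * (d ⬝ᵥ (A⁻¹ *ᵥ S)) * η + (d ⬝ᵥ (A⁻¹ *ᵥ d)) * η ^ 2 - (d ⬝ᵥ (A⁻¹ *ᵥ S)) ^ 2) /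
          (1 + d ⬝ᵥ (A⁻¹ *ᵥ d)) := by
  have hw : 0 < 1 + d ⬝ᵥ (A⁻¹ *ᵥ d) := by
    linarith [hA.inv.posSemidef.dotProduct_mulVec_self_nonneg d]
  rw [hA.inv_add_vecMulVec]
  have h2 := hA.inv.isHermitian.dotProduct_mulVec_comm S d
  have h3 : (A⁻¹ *ᵥ d) ⬝ᵥ S = d ⬝ᵥ (A⁻¹ *ᵥ S) := by rw [dotProduct_comm, h2]
  have h4 : (A⁻¹ *ᵥ d) ⬝ᵥ d = d ⬝ᵥ (A⁻¹ *ᵥ d) := dotProduct_comm _ _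
  simp only [sub_mulVec, smul_mulVec, vecMulVec_mulVec, mulVec_add, mulVec_smul, add_dotProduct,
    dotProduct_add, smul_dotProduct, dotProduct_smul, dotProduct_sub, smul_eq_mul, h2, h3, h4,
    op_smul_eq_smul]
  field_simp
  ring

/-- The matrix determinant lemma for a symmetric rank-one update. -/
lemma Matrix.PosDef.det_add_vecMulVec {A : Matrix n n ℝ} (hA : A.PosDef) (d : n → ℝ) :
    (A + vecMulVec d d).det = A.det * (1 + d ⬝ᵥ (A⁻¹ *ᵥ d)) := by
  have hdet : IsUnit A.det := A.isUnit_iff_isUnit_det.1 hA.isUnit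
  rw [vecMulVec_eq Unit, det_add_replicateCol_mul_replicateRow hdet]
  congr 1
  rw [det_unique, add_apply, one_apply_eq, Matrix.mul_assoc, ← replicateCol_mulVec,
    replicateRow_mul_replicateCol_apply]

/-- An upper bound for the quadratic form bounds all eigenvalues, hence the determinant. -/
lemma Matrix.PosDef.det_le_pow_card {A : Matrix n n ℝ} (hA : A.PosDef) {b : ℝ}
    (h : ∀ x : n → ℝ, x ⬝ᵥ (A *ᵥ x) ≤ b * (x ⬝ᵥ x)) : A.det ≤ b ^ Fintype.card n := by
  have hev : ∀ i, hA.isHermitian.eigenvalues i ≤ b := by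
    intro i
    have hone := hA.isHermitian.eigenvectorBasis.orthonormal.1 i
    rw [hA.isHermitian.eigenvalues_eq]
    have h1 := h (hA.isHermitian.eigenvectorBasis i)
    have h2 : (hA.isHermitian.eigenvectorBasis i : n → ℝ) ⬝ᵥ
        (hA.isHermitian.eigenvectorBasis i : n → ℝ) = 1 := by
      have := EuclideanSpace.real_norm_sq_eq (hA.isHermitian.eigenvectorBasis i)
      rw [hone] at this
      simp only [dotProduct, ← sq]
      linarith
    rw [h2, mul_one] at h1
    simpa using h1
  rw [hA.isHermitian.det_eq_prod_eigenvalues]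
  calc _ ≤ ∏ _i : n, b := Finset.prod_le_prod (fun i _ => (hA.eigenvalues_pos i).le)
            (fun i _ => by simpa using hev i)
    _ = _ := by simp

/-- Inversion reverses the bound `lam • 1 ≤ A`. -/
lemma Matrix.PosDef.quadForm_inv_le {A : Matrix n n ℝ} (hA : A.PosDef) {lam : ℝ} (hl : 0 < lam)
    (h : ∀ x : n → ℝ, lam * (x ⬝ᵥ x) ≤ x ⬝ᵥ (A *ᵥ x)) (x : n → ℝ) :
    x ⬝ᵥ (A⁻¹ *ᵥ x) ≤ (x ⬝ᵥ x) / lam := by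
  have hdet : IsUnit A.det := A.isUnit_iff_isUnit_det.1 hA.isUnit
  have h1 := h (A⁻¹ *ᵥ x)
  rw [mulVec_mulVec, mul_nonsing_inv _ hdet, one_mulVec, dotProduct_comm _ x] at h1
  -- `0 ≤ |lam A⁻¹ x - x|²`
  have h2 : 0 ≤ (lam • (A⁻¹ *ᵥ x) - x) ⬝ᵥ (lam • (A⁻¹ *ᵥ x) - x) := by
    simpa using dotProduct_star_self_nonneg (lam • (A⁻¹ *ᵥ x) - x)
  simp only [sub_dotProduct, dotProduct_sub, smul_dotProduct, dotProduct_smul, smul_eq_mul,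
    dotProduct_comm (A⁻¹ *ᵥ x) x] at h2
  rw [le_div_iff₀ hl]
  nlinarith [mul_le_mul_of_nonneg_left h1 hl.le]

end LinearAlgebra

section Gram

variable {S A : Type*} [DecidableEq S] [DecidableEq A] {H : ℕ}

lemma gramMatrix_succ (lam : ℝ) (τ : ℕ → Episode S A H) (k : ℕ) :
    gramMatrix lam τ (k + 1) =
      gramMatrix lam τ k + vecMulVec (visitCount (τ k)) (visitCount (τ k)) := by
  simp [gramMatrix, Finset.sum_range_succ, add_assoc]

lemma gramMatrix_zero (lam : ℝ) (τ : ℕ → Episode S A H) :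
    gramMatrix lam τ 0 = lam • (1 : Matrix (S × A) (S × A) ℝ) := by
  simp [gramMatrix]

lemma visitCount_nonneg (τ : Episode S A H) (z : S × A) : 0 ≤ visitCount τ z :=
  Finset.sum_nonneg fun _ _ => by split_ifs <;> norm_num

variable [Fintype S] [Fintype A]

lemma gramMatrix_posDef {lam : ℝ} (hl : 0 < lam) (τ : ℕ → Episode S A H) (k : ℕ) :
    (gramMatrix lam τ k).PosDef := by
  induction k with
  | zero => rw [gramMatrix_zero]; exact PosDef.one.smul hl
  | succ k ih => rw [gramMatrix_succ]; exact ih.posDef_add_vecMulVec _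

lemma visitCount_dotProduct (τ : Episode S A H) (r : S × A → ℝ) :
    visitCount τ ⬝ᵥ r = ∑ h, r (τ h).1 := by
  simp only [dotProduct, visitCount, Finset.sum_mul]
  rw [Finset.sum_comm]
  simp

lemma visitCount_dotProduct_self_le (τ : Episode S A H) :
    visitCount τ ⬝ᵥ visitCount τ ≤ (H : ℝ) ^ 2 := by
  rw [visitCount_dotProduct]
  have h : ∀ z, visitCount τ z ≤ H := fun z =>
    (Finset.sum_le_sum fun _ _ => by split_ifs <;> norm_num).trans
      (b := ∑ _h : Fin H, (1 : ℝ)) (by simp)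
  calc _ ≤ ∑ _h : Fin H, (H : ℝ) := Finset.sum_le_sum fun _ _ => h _
    _ = _ := by simp [sq]

lemma gramMatrix_quadForm (lam : ℝ) (τ : ℕ → Episode S A H) (k : ℕ) (x : S × A → ℝ) :
    x ⬝ᵥ (gramMatrix lam τ k *ᵥ x) =
      lam * (x ⬝ᵥ x) + ∑ l ∈ Finset.range k, (visitCount (τ l) ⬝ᵥ x) ^ 2 := by
  induction k with
  | zero => simp [gramMatrix_zero, smul_mulVec]
  | succ k ih =>
    rw [gramMatrix_succ, add_mulVec, dotProduct_add, ih, Finset.sum_range_succ, vecMulVec_mulVec,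
      op_smul_eq_smul, dotProduct_smul, smul_eq_mul, dotProduct_comm x (visitCount (τ k)),
      ← sq, add_assoc]

lemma le_gramMatrix_quadForm (lam : ℝ) (τ : ℕ → Episode S A H) (k : ℕ) (x : S × A → ℝ) :
    lam * (x ⬝ᵥ x) ≤ x ⬝ᵥ (gramMatrix lam τ k *ᵥ x) := by
  rw [gramMatrix_quadForm]
  exact le_add_of_nonneg_right (Finset.sum_nonneg fun _ _ => sq_nonneg _)

lemma gramMatrix_quadForm_le (lam : ℝ) (τ : ℕ → Episode S A H) (k : ℕ) (x : S × A → ℝ) :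
    x ⬝ᵥ (gramMatrix lam τ k *ᵥ x) ≤ (lam + k * (H : ℝ) ^ 2) * (x ⬝ᵥ x) := by
  rw [gramMatrix_quadForm, add_mul]
  gcongr
  have hx : 0 ≤ x ⬝ᵥ x := by simpa using dotProduct_star_self_nonneg x
  have h : ∀ l ∈ Finset.range k, (visitCount (τ l) ⬝ᵥ x) ^ 2 ≤ (H : ℝ) ^ 2 * (x ⬝ᵥ x) := by
    intro l _
    refine le_trans ?_ (mul_le_mul_of_nonneg_right (visitCount_dotProduct_self_le (τ l)) hx)
    simpa [dotProduct, sq] using Finset.sum_mul_sq_le_sq_mul_sq Finset.univ (visitCount (τ l)) x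
  refine (Finset.sum_le_sum h).trans ?_
  simp [mul_assoc]

lemma quadForm_gramMatrix_inv_le {lam : ℝ} (hl : 0 < lam) (τ : ℕ → Episode S A H) (k : ℕ)
    (x : S × A → ℝ) : x ⬝ᵥ ((gramMatrix lam τ k)⁻¹ *ᵥ x) ≤ (x ⬝ᵥ x) / lam :=
  (gramMatrix_posDef hl τ k).quadForm_inv_le hl (le_gramMatrix_quadForm lam τ k) x

/-- The elliptical potential: the widths of the observed directions multiply up to a ratio of
determinants, which grows only polynomially in the number of episodes. -/
lemma prod_one_add_width_le {lam : ℝ} (hl : 0 < lam) (τ : ℕ → Episode S A H) (k : ℕ) :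
    ∏ l ∈ Finset.range k,
        (1 + visitCount (τ l) ⬝ᵥ ((gramMatrix lam τ l)⁻¹ *ᵥ visitCount (τ l))) ≤
      (1 + k * (H : ℝ) ^ 2 / lam) ^ (Fintype.card S * Fintype.card A) := by
  have h1 : (gramMatrix lam τ k).det = lam ^ (Fintype.card S * Fintype.card A) *
      ∏ l ∈ Finset.range k,
        (1 + visitCount (τ l) ⬝ᵥ ((gramMatrix lam τ l)⁻¹ *ᵥ visitCount (τ l))) := by
    induction k with
    | zero => simp [gramMatrix_zero]
    | succ k ih =>
      rw [gramMatrix_succ, (gramMatrix_posDef hl τ k).det_add_vecMulVec, ih,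
        Finset.prod_range_succ, mul_assoc]
  have h2 := (gramMatrix_posDef hl τ k).det_le_pow_card (gramMatrix_quadForm_le lam τ k)
  rw [h1, Fintype.card_prod] at h2
  have h3 : lam + k * (H : ℝ) ^ 2 = lam * (1 + k * (H : ℝ) ^ 2 / lam) := by field_simp
  rw [h3, mul_pow] at h2
  exact le_of_mul_le_mul_left h2 (by positivity)

end Gram

/-! ### Ville's inequality, disintegration and the method of mixtures -/

section Supermartingale

open scoped ENNReal

variable {Ω : Type*} {mΩ : MeasurableSpace Ω}

/-- **Ville's inequality** for a nonnegative supermartingale, in the form that is localized to an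
event of the σ-algebra at the starting time and restricted to finitely many times. -/
lemma mul_measure_inter_exists_le_setLIntegral (μ : Measure Ω) (F : Filtration ℕ mΩ)
    {M : ℕ → Ω → ℝ≥0∞} (hM : ∀ k, Measurable[F k] (M k))
    (hstep : ∀ k E, MeasurableSet[F k] E → ∫⁻ ω in E, M (k + 1) ω ∂μ ≤ ∫⁻ ω in E, M k ω ∂μ)
    (c : ℝ≥0∞) (m : ℕ) : ∀ (j : ℕ) (E : Set Ω), MeasurableSet[F j] E →
      c * μ (E ∩ {ω | ∃ i < m, c ≤ M (j + i) ω}) ≤ ∫⁻ ω in E, M j ω ∂μ := by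
  induction m with
  | zero => intro j E _; simp
  | succ m ih =>
    intro j E hE
    have hD : MeasurableSet[F j] {ω | c ≤ M j ω} := measurableSet_le measurable_const (hM j)
    have hE' : MeasurableSet[F j] (E \ {ω | c ≤ M j ω}) := hE.diff hD
    have hsub : E ∩ {ω | ∃ i < m + 1, c ≤ M (j + i) ω} ⊆ (E ∩ {ω | c ≤ M j ω}) ∪
        ((E \ {ω | c ≤ M j ω}) ∩ {ω | ∃ i < m, c ≤ M (j + 1 + i) ω}) := by
      rintro ω ⟨hω, i, hi, hc⟩
      by_cases h : c ≤ M j ω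
      · exact Or.inl ⟨hω, h⟩
      · refine Or.inr ⟨⟨hω, h⟩, ?_⟩
        rcases i with _ | i
        · exact absurd hc h
        · exact ⟨i, by omega, by rwa [add_assoc, add_comm 1 i]⟩
    calc c * μ (E ∩ {ω | ∃ i < m + 1, c ≤ M (j + i) ω})
        ≤ c * μ (E ∩ {ω | c ≤ M j ω}) + c * μ ((E \ {ω | c ≤ M j ω}) ∩
            {ω | ∃ i < m, c ≤ M (j + 1 + i) ω}) := by
          rw [← mul_add]
          gcongr
          exact (measure_mono hsub).trans (measure_union_le _ _)
      _ ≤ ∫⁻ ω in E ∩ {ω | c ≤ M j ω}, M j ω ∂μ +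
            ∫⁻ ω in E \ {ω | c ≤ M j ω}, M j ω ∂μ := by
          gcongr
          · rw [← setLIntegral_const]
            exact setLIntegral_mono' (F.le j _ (hE.inter hD)) fun ω hω => hω.2
          · exact (ih (j + 1) _ (F.mono (Nat.le_succ j) _ hE')).trans (hstep j _ hE')
      _ = _ := lintegral_inter_add_sdiff _ _ (F.le j _ hD)

/-- **Ville's inequality** for a nonnegative supermartingale. -/
lemma mul_measure_exists_le_lintegral (μ : Measure Ω) (F : Filtration ℕ mΩ)
    {M : ℕ → Ω → ℝ≥0∞} (hM : ∀ k, Measurable[F k] (M k))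
    (hstep : ∀ k E, MeasurableSet[F k] E → ∫⁻ ω in E, M (k + 1) ω ∂μ ≤ ∫⁻ ω in E, M k ω ∂μ)
    (c : ℝ≥0∞) : c * μ {ω | ∃ k, c ≤ M k ω} ≤ ∫⁻ ω, M 0 ω ∂μ := by
  have hU : {ω | ∃ k, c ≤ M k ω} = ⋃ m : ℕ, {ω | ∃ i < m, c ≤ M i ω} := by
    ext ω
    simp only [Set.mem_ofPred_eq, Set.mem_iUnion]
    exact ⟨fun ⟨k, hk⟩ => ⟨k + 1, k, Nat.lt_succ_self k, hk⟩, fun ⟨_, k, _, hk⟩ => ⟨k, hk⟩⟩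
  have hmono : Monotone fun m : ℕ => {ω | ∃ i < m, c ≤ M i ω} :=
    fun m m' h ω ⟨i, hi, hc⟩ => ⟨i, hi.trans_le h, hc⟩
  rw [hU, hmono.measure_iUnion, ENNReal.mul_iSup]
  refine iSup_le fun m => ?_
  have := mul_measure_inter_exists_le_setLIntegral μ F hM hstep c m 0 Set.univ MeasurableSet.univ
  simpa using this

/-- If `κ` is the conditional law of `τ` given the `m`-measurable information, then a function of
that information and of `τ` may be integrated by integrating over `κ` first. -/
lemma lintegral_eq_lintegral_lintegral_of_condLaw {T : Type*} [MeasurableSpace T] {μ : Measure Ω}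
    [IsProbabilityMeasure μ] {m : MeasurableSpace Ω} (hm : m ≤ mΩ) (κ : @Kernel Ω T m _)
    [@IsFiniteKernel Ω T m _ κ] {τ : Ω → T} (hτ : Measurable[mΩ] τ)
    (hκ : ∀ B : Set T, MeasurableSet B →
      μ[(τ ⁻¹' B).indicator (fun _ => (1 : ℝ)) | m] =ᵐ[μ] fun ω => (κ ω).real B)
    {f : Ω → T → ℝ≥0∞} (hf : Measurable[m.prod inferInstance] (Function.uncurry f)) :
    ∫⁻ ω, f ω (τ ω) ∂μ = ∫⁻ ω, ∫⁻ t, f ω t ∂(κ ω) ∂μ := by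
  have hG : @Measurable Ω (Ω × T) mΩ (m.prod inferInstance) fun ω => (ω, τ ω) :=
    Measurable.prodMk (measurable_id'' hm) hτ
  have key : @Measure.map Ω (Ω × T) mΩ (m.prod inferInstance) (fun ω => (ω, τ ω)) μ =
      @Measure.compProd Ω T m _ (μ.trim hm) κ := by
    have : IsProbabilityMeasure
        (@Measure.map Ω (Ω × T) mΩ (m.prod inferInstance) (fun ω => (ω, τ ω)) μ) :=
      Measure.isProbabilityMeasure_map hG.aemeasurable
    refine @Measure.ext_prod Ω T m _ _ _ _ fun {C B} hC hB => ?_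
    have hκB : Measurable[m] fun ω => κ ω B := Kernel.measurable_coe κ hB
    rw [Measure.map_apply hG (hC.prod hB), Measure.compProd_apply_prod hC hB,
      restrict_trim hm _ hC, lintegral_trim hm hκB]
    have hpre : (fun ω => (ω, τ ω)) ⁻¹' (C ×ˢ B) = τ ⁻¹' B ∩ C := by
      ext ω; simp [and_comm]
    have h1 : ∫ ω in C, (τ ⁻¹' B).indicator (fun _ => (1 : ℝ)) ω ∂μ =
        ∫ ω in C, (κ ω).real B ∂μ := by
      rw [← setIntegral_condExp hm ((integrable_const _).indicator (hτ hB)) hC]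
      exact setIntegral_congr_ae (hm _ hC) ((hκ B hB).mono fun ω h _ => h)
    rw [integral_indicator_const _ (hτ hB), smul_eq_mul, mul_one,
      measureReal_restrict_apply (hτ hB)] at h1
    simp only [measureReal_def] at h1
    rw [integral_toReal (hκB.mono hm le_rfl).aemeasurable
      (ae_of_all _ fun ω => measure_lt_top _ _)] at h1
    rw [hpre]
    refine (ENNReal.toReal_eq_toReal_iff' (measure_ne_top _ _) ?_).1 h1
    refine ne_top_of_le_ne_top ?_
      (setLIntegral_mono' (hm _ hC) fun ω _ => Kernel.measure_le_bound κ ω B)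
    rw [setLIntegral_const]
    exact ENNReal.mul_ne_top (Kernel.bound_ne_top κ) (measure_ne_top _ _)
  have h1 : ∫⁻ ω, f ω (τ ω) ∂μ = ∫⁻ p, Function.uncurry f p
      ∂(@Measure.map Ω (Ω × T) mΩ (m.prod inferInstance) (fun ω => (ω, τ ω)) μ) :=
    (@lintegral_map Ω (Ω × T) mΩ (m.prod inferInstance) μ _ _ hf hG).symm
  rw [h1, key, Measure.lintegral_compProd hf]
  exact lintegral_trim hm (hf.lintegral_kernel_prod_right' (κ := κ))

end Supermartingale

section Mixture

/-- Completing the square under a Gaussian integral. -/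
lemma lintegral_exp_quadratic_gaussianReal {b a w : ℝ} (hb : 0 < b) (ha : 0 < a) (hw : 0 < w)
    (hbw : b * (a * (1 + w)) = w) (c : ℝ) :
    ∫⁻ g, ENNReal.ofReal (Real.exp (c * g + a * g ^ 2 / 2)) ∂(gaussianReal 0 b.toNNReal) =
      ENNReal.ofReal (√(1 + w) * Real.exp (c ^ 2 * (w / a) / 2)) := by
  have hb0 : b.toNNReal ≠ 0 := by simpa using hb
  have hv : 0 < w / a := by positivity
  have hv0 : (w / a).toNNReal ≠ 0 := by simpa using hv
  rw [gaussianReal_of_var_ne_zero _ hb0, lintegral_withDensity_eq_lintegral_mul _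
    (measurable_gaussianPDF _ _) (by fun_prop)]
  -- the integrand is a multiple of the density of another Gaussian, with variance `w / a`
  have key : ∀ g : ℝ, (gaussianPDF 0 b.toNNReal * fun g =>
      ENNReal.ofReal (Real.exp (c * g + a * g ^ 2 / 2))) g =
      ENNReal.ofReal (√(1 + w) * Real.exp (c ^ 2 * (w / a) / 2)) *
        ENNReal.ofReal (gaussianPDFReal (c * (w / a)) (w / a).toNNReal g) := by
    intro g
    rw [Pi.mul_apply, gaussianPDF, ← ENNReal.ofReal_mul (gaussianPDFReal_nonneg _ _ _),
      ← ENNReal.ofReal_mul (by positivity)]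
    congr 1
    rw [gaussianPDFReal, gaussianPDFReal, Real.coe_toNNReal _ hb.le, Real.coe_toNNReal _ hv.le]
    have hva : w / a = b * (1 + w) := by rw [div_eq_iff ha.ne']; linarith
    have hs : √(2 * Real.pi * (w / a)) = √(2 * Real.pi * b) * √(1 + w) := by
      rw [← Real.sqrt_mul (by positivity), hva]; ring_nf
    have hs1 : 0 < √(1 + w) := Real.sqrt_pos.2 (by linarith)
    have hs2 : 0 < √(2 * Real.pi * b) := Real.sqrt_pos.2 (by positivity)
    rw [hs]
    have e1 : ∀ x y : ℝ, (√(2 * Real.pi * b))⁻¹ * Real.exp x * Real.exp y =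
        (√(2 * Real.pi * b))⁻¹ * Real.exp (x + y) := by
      intro x y; rw [Real.exp_add]; ring
    have e2 : ∀ x y : ℝ, √(1 + w) * Real.exp x *
        ((√(2 * Real.pi * b) * √(1 + w))⁻¹ * Real.exp y) =
        (√(2 * Real.pi * b))⁻¹ * Real.exp (x + y) := by
      intro x y; rw [Real.exp_add]; field_simp
    rw [e1, e2]
    congr 2
    have hbe : b = w / (a * (1 + w)) := by rw [eq_div_iff (by positivity), hbw]
    rw [hbe]
    field_simp
    ring
  simp_rw [key]
  rw [lintegral_const_mul _ (by fun_prop), lintegral_gaussianPDFReal_eq_one _ hv0, mul_one]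

/-- The method of mixtures for one step of the self-normalized process. The exponential of a square
is a Gaussian mixture of exponentials of multiples of `η`; each of these is controlled by the
sub-Gaussian hypothesis. -/
lemma lintegral_exp_selfNormalized_le {T : Type*} [MeasurableSpace T] (ν : Measure T) [SFinite ν]
    {η : T → ℝ} (hη : Measurable η) {a : ℝ} (ha : 0 < a)
    (hsub : ∀ θ : ℝ, ∫⁻ t, ENNReal.ofReal (Real.exp (θ * η t)) ∂ν ≤
      ENNReal.ofReal (Real.exp (a * θ ^ 2 / 2)))
    {u w : ℝ} (hw : 0 ≤ w) (huw : w = 0 → u = 0) :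
    ∫⁻ t, ENNReal.ofReal
        (Real.exp ((2 * u * η t + w * η t ^ 2 - u ^ 2) / (2 * a * (1 + w))) / √(1 + w)) ∂ν ≤ 1 := by
  -- for `w = 0` the mixing Gaussian degenerates, but then `u = 0` too
  rcases hw.eq_or_lt with rfl | hw
  · simpa [huw rfl] using hsub 0
  set b := w / (a * (1 + w)) with hb_def
  have hb : 0 < b := by positivity
  have hbw : b * (a * (1 + w)) = w := by rw [hb_def]; field_simp
  set c := u / w with hc_def
  set Z := Real.exp (-(u ^ 2 / (2 * w * a))) / √(1 + w) with hZ_def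
  have hZ : 0 ≤ Z := by positivity
  have e1 : ∀ t, ENNReal.ofReal
      (Real.exp ((2 * u * η t + w * η t ^ 2 - u ^ 2) / (2 * a * (1 + w))) / √(1 + w)) =
      ENNReal.ofReal Z * ∫⁻ g, ENNReal.ofReal (Real.exp (c * g) * Real.exp (g * η t))
        ∂(gaussianReal 0 b.toNNReal) := by
    intro t
    have hi := integrable_exp_mul_gaussianReal (μ := 0) (v := b.toNNReal) (c + η t)
    have hmgf := congrFun (mgf_fun_id_gaussianReal (μ := 0) (v := b.toNNReal)) (c + η t)
    rw [mgf, zero_mul, zero_add, Real.coe_toNNReal _ hb.le] at hmgf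
    have : ∀ g : ℝ, Real.exp (c * g) * Real.exp (g * η t) = Real.exp ((c + η t) * g) := by
      intro g; rw [← Real.exp_add]; ring_nf
    simp_rw [this]
    rw [← ofReal_integral_eq_lintegral_ofReal hi (ae_of_all _ fun g => (Real.exp_pos _).le), hmgf,
      ← ENNReal.ofReal_mul hZ, hZ_def, div_mul_eq_mul_div, ← Real.exp_add]
    congr 3
    rw [hb_def, hc_def]
    field_simp
    ring
  simp_rw [e1]
  rw [lintegral_const_mul _ (by
    apply Measurable.lintegral_prod_right' (f := fun p : T × ℝ =>
      ENNReal.ofReal (Real.exp (c * p.2) * Real.exp (p.2 * η p.1)))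
    fun_prop), lintegral_lintegral_swap (by fun_prop)]
  calc _ ≤ ENNReal.ofReal Z * ∫⁻ g, ENNReal.ofReal (Real.exp (c * g + a * g ^ 2 / 2))
        ∂(gaussianReal 0 b.toNNReal) := by
        gcongr with g
        simp_rw [Real.exp_add, ENNReal.ofReal_mul (Real.exp_pos (c * g)).le]
        rw [lintegral_const_mul _ (by fun_prop)]
        gcongr
        exact hsub g
    _ = 1 := by
        rw [lintegral_exp_quadratic_gaussianReal hb ha hw hbw, ← ENNReal.ofReal_mul hZ,
          ← ENNReal.ofReal_one, hZ_def]
        congr 1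
        have hs1 : 0 < √(1 + w) := Real.sqrt_pos.2 (by linarith)
        have : c ^ 2 * (w / a) / 2 = u ^ 2 / (2 * w * a) := by rw [hc_def]; field_simp
        rw [this, Real.exp_neg]
        field_simp

end Mixture

/-! ### The law of an episode -/

section EpisodeLaw

open scoped ENNReal

variable {S A : Type*} {H : ℕ}

lemma FiniteMDP.meanReward_mem_Icc (M : FiniteMDP S A) (z : S × A) :
    M.meanReward z ∈ Set.Icc (0 : ℝ) 1 := by
  refine ⟨integral_nonneg fun x => x.2.1, ?_⟩
  have h := integral_mono_of_nonneg (μ := (M.rewardLaw z.1 z.2 : Measure unitInterval))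
    (f := fun x => (x : ℝ)) (g := fun _ => 1) (ae_of_all _ fun x => x.2.1) (integrable_const _)
    (ae_of_all _ fun x => x.2.2)
  simpa [meanReward] using h

lemma FiniteMDP.pathProb_le_one [DecidableEq S] (M : FiniteMDP S A) (π : DetPolicy S A H) (s₁ : S)
    (x : Fin H → S) : M.pathProb π s₁ x ≤ 1 := by
  refine Finset.prod_le_one' fun h _ => ?_
  split_ifs
  · exact le_rfl
  · exact zero_le_one
  · exact PMF.coe_le_one _ _

variable [MeasurableSpace S] [MeasurableSpace A]

/-- The law of an episode given the visited state-action pairs `z`. -/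
noncomputable def FiniteMDP.rewardsLaw (M : FiniteMDP S A) (z : Fin H → S × A) :
    Measure (Episode S A H) :=
  Measure.pi fun h => (Measure.dirac (z h)).prod
    (M.rewardLaw (z h).1 (z h).2 : Measure unitInterval)

instance (M : FiniteMDP S A) (z : Fin H → S × A) : IsProbabilityMeasure (M.rewardsLaw z) := by
  unfold FiniteMDP.rewardsLaw; infer_instance

/-- Given the visited pairs, the sum of the `H` centred rewards is sub-Gaussian with variance proxy
`H / 4`, by Hoeffding's lemma and independence. -/
lemma FiniteMDP.lintegral_exp_noise_rewardsLaw_le (M : FiniteMDP S A) (z : Fin H → S × A) (θ : ℝ) :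
    ∫⁻ t, ENNReal.ofReal (Real.exp (θ * ∑ h, (((t h).2 : ℝ) - M.meanReward (z h))))
      ∂(M.rewardsLaw z) ≤ ENNReal.ofReal (Real.exp ((H : ℝ) / 4 * θ ^ 2 / 2)) := by
  have hmgf : ∀ z : S × A, Integrable (fun y : unitInterval =>
        Real.exp (θ * ((y : ℝ) - M.meanReward z))) (M.rewardLaw z.1 z.2 : Measure unitInterval) ∧
      ∫ y : unitInterval, Real.exp (θ * ((y : ℝ) - M.meanReward z))
        ∂(M.rewardLaw z.1 z.2 : Measure unitInterval) ≤ Real.exp (1 / 4 * θ ^ 2 / 2) := by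
    intro z
    have h := hasSubgaussianMGF_of_mem_Icc (μ := (M.rewardLaw z.1 z.2 : Measure unitInterval))
      (X := fun y => (y : ℝ)) (a := 0) (b := 1) (by fun_prop) (ae_of_all _ fun y => y.2)
    -- the variance proxy of a variable in `[0, 1]` is `(1 / 2) ^ 2`
    refine ⟨h.integrable_exp_mul θ, (h.mgf_le θ).trans_eq ?_⟩
    norm_num
  have hint : ∀ h : Fin H, Integrable (fun p : (S × A) × unitInterval =>
      Real.exp (θ * ((p.2 : ℝ) - M.meanReward (z h)))) ((Measure.dirac (z h)).prod
        (M.rewardLaw (z h).1 (z h).2 : Measure unitInterval)) := fun h => (hmgf (z h)).1.comp_snd _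
  have hprod : ∀ t : Episode S A H, Real.exp (θ * ∑ h, (((t h).2 : ℝ) - M.meanReward (z h))) =
      ∏ h, Real.exp (θ * (((t h).2 : ℝ) - M.meanReward (z h))) := by
    intro t; rw [Finset.mul_sum, Real.exp_sum]
  simp_rw [hprod]
  rw [rewardsLaw, ← ofReal_integral_eq_lintegral_ofReal (Integrable.fintype_prod_dep
    (f := fun h (p : (S × A) × unitInterval) =>
      Real.exp (θ * ((p.2 : ℝ) - M.meanReward (z h)))) hint)
    (ae_of_all _ fun t => Finset.prod_nonneg fun _ _ => (Real.exp_pos _).le)]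
  refine ENNReal.ofReal_le_ofReal ?_
  rw [integral_fintype_prod_eq_prod (fun h (p : (S × A) × unitInterval) =>
      Real.exp (θ * ((p.2 : ℝ) - M.meanReward (z h))))]
  calc _ ≤ ∏ _h : Fin H, Real.exp (1 / 4 * θ ^ 2 / 2) := by
        refine Finset.prod_le_prod (fun h _ => integral_nonneg fun _ => (Real.exp_pos _).le)
          fun h _ => ?_
        rw [integral_fun_snd (fun y : unitInterval =>
          Real.exp (θ * ((y : ℝ) - M.meanReward (z h))))]
        simpa using (hmgf (z h)).2
    _ = _ := by
        rw [Finset.prod_const, Finset.card_univ, Fintype.card_fin, ← Real.exp_nat_mul]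
        ring_nf

lemma FiniteMDP.ae_fst_eq_rewardsLaw [MeasurableSingletonClass S] [MeasurableSingletonClass A]
    (M : FiniteMDP S A) (z : Fin H → S × A) :
    ∀ᵐ t ∂(M.rewardsLaw z), ∀ h, (t h).1 = z h := by
  rw [ae_all_iff]
  intro h
  have h1 : ∀ᵐ p ∂((Measure.dirac (z h)).prod
      (M.rewardLaw (z h).1 (z h).2 : Measure unitInterval)), p.1 = z h := by
    refine Measure.quasiMeasurePreserving_fst.ae (p := fun p : S × A => p = z h) ?_
    rw [ae_dirac_eq]
    exact Filter.mem_pure.2 rfl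
  exact (Measure.quasiMeasurePreserving_eval (fun h => (Measure.dirac (z h)).prod
    (M.rewardLaw (z h).1 (z h).2 : Measure unitInterval)) h).ae h1

variable [DecidableEq S]

variable [Fintype S]

lemma FiniteMDP.episodeLaw_eq_sum (M : FiniteMDP S A) (π : DetPolicy S A H) (s₁ : S) :
    M.episodeLaw π s₁ =
      ∑ x : Fin H → S, M.pathProb π s₁ x • M.rewardsLaw fun h => (x h, π (x h) h) := rfl

lemma FiniteMDP.episodeLaw_univ (M : FiniteMDP S A) (π : DetPolicy S A H) (s₁ : S) :
    M.episodeLaw π s₁ Set.univ = ∑ x : Fin H → S, M.pathProb π s₁ x := by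
  simp [episodeLaw_eq_sum]

lemma FiniteMDP.episodeLaw_univ_le (M : FiniteMDP S A) (π : DetPolicy S A H) (s₁ : S) :
    M.episodeLaw π s₁ Set.univ ≤ Fintype.card (Fin H → S) := by
  rw [episodeLaw_univ]
  exact (Finset.sum_le_sum fun x _ => M.pathProb_le_one π s₁ x).trans (by simp)

instance (M : FiniteMDP S A) (π : DetPolicy S A H) (s₁ : S) :
    IsFiniteMeasure (M.episodeLaw π s₁) :=
  ⟨(M.episodeLaw_univ_le π s₁).trans_lt (ENNReal.natCast_lt_top _)⟩

variable [Fintype A] [MeasurableSingletonClass S] [MeasurableSingletonClass A]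

/-- The kernel that assigns to a policy and an initial state the law of the episode. -/
noncomputable def FiniteMDP.episodeKernel (M : FiniteMDP S A) (H : ℕ) :
    Kernel (DetPolicy S A H × S) (Episode S A H) where
  toFun p := M.episodeLaw p.1 p.2
  measurable' := measurable_of_finite _

instance (M : FiniteMDP S A) : IsFiniteKernel (M.episodeKernel H) :=
  ⟨Fintype.card (Fin H → S), ENNReal.natCast_lt_top _, fun p => M.episodeLaw_univ_le p.1 p.2⟩

end EpisodeLaw

section Measurability

variable {S A : Type*} [DecidableEq S] [DecidableEq A] [MeasurableSpace S] [MeasurableSpace A]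
  [MeasurableSingletonClass S] [MeasurableSingletonClass A] {H : ℕ}

lemma measurable_visitCount (z : S × A) :
    Measurable fun t : Episode S A H => visitCount t z := by
  unfold visitCount
  refine Finset.measurable_sum _ fun h _ => Measurable.ite ?_ measurable_const measurable_const
  exact (measurable_pi_apply h).fst (measurableSet_singleton z)

end Measurability

/-! ### Feedback noise and occupancy measures -/

section Noise

lemma measurable_cumReward {S A : Type*} [MeasurableSpace S] [MeasurableSpace A] {H : ℕ} :
    Measurable (cumReward : Episode S A H → ℝ) := by
  unfold cumReward
  exact Finset.measurable_sum _ fun h _ =>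
    measurable_subtype_coe.comp (measurable_pi_apply h).snd

variable {S A : Type*} [Fintype S] [Fintype A] [DecidableEq S] [DecidableEq A] {H : ℕ}

/-- The noise of the trajectory feedback: the deviation of the cumulative reward of an episode from
the sum of the mean rewards of the visited pairs. -/
noncomputable def FiniteMDP.noise (M : FiniteMDP S A) (t : Episode S A H) : ℝ :=
  cumReward t - visitCount t ⬝ᵥ M.meanReward

/-- The noise-weighted sum `∑ η d̂` of the visit counts of the first `k` episodes. -/
noncomputable def FiniteMDP.noiseSum (M : FiniteMDP S A) (τ : ℕ → Episode S A H) (k : ℕ) :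
    S × A → ℝ :=
  ∑ l ∈ Finset.range k, M.noise (τ l) • visitCount (τ l)

/-- One factor of the self-normalized exponential supermartingale: the growth of
`exp (‖v‖²_B / (2 a)) / √(det B⁻¹)` when `v` changes to `v + η • d` and `B⁻¹` to `B⁻¹ + d dᵀ`. -/
noncomputable def selfNormalizedFactor {n : Type*} [Fintype n] (a : ℝ) (B : Matrix n n ℝ)
    (v d : n → ℝ) (η : ℝ) : ℝ :=
  Real.exp ((2 * (d ⬝ᵥ (B *ᵥ v)) * η + (d ⬝ᵥ (B *ᵥ d)) * η ^ 2 - (d ⬝ᵥ (B *ᵥ v)) ^ 2) /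
    (2 * a * (1 + d ⬝ᵥ (B *ᵥ d)))) / √(1 + d ⬝ᵥ (B *ᵥ d))

lemma selfNormalizedFactor_nonneg {n : Type*} [Fintype n] (a : ℝ) (B : Matrix n n ℝ)
    (v d : n → ℝ) (η : ℝ) : 0 ≤ selfNormalizedFactor a B v d η :=
  div_nonneg (Real.exp_pos _).le (Real.sqrt_nonneg _)

/-- The factors telescope, so that their product is the self-normalized exponential process. -/
lemma prod_selfNormalizedFactor {lam a : ℝ} (hl : 0 < lam) (ha : 0 < a) (M : FiniteMDP S A)
    (τ : ℕ → Episode S A H) (k : ℕ) :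
    ∏ l ∈ Finset.range k, selfNormalizedFactor a (gramMatrix lam τ l)⁻¹ (M.noiseSum τ l)
        (visitCount (τ l)) (M.noise (τ l)) =
      Real.exp (M.noiseSum τ k ⬝ᵥ ((gramMatrix lam τ k)⁻¹ *ᵥ M.noiseSum τ k) / (2 * a)) /
        √(∏ l ∈ Finset.range k,
          (1 + visitCount (τ l) ⬝ᵥ ((gramMatrix lam τ l)⁻¹ *ᵥ visitCount (τ l)))) := by
  induction k with
  | zero => simp [FiniteMDP.noiseSum]
  | succ k ih =>
    have hA := gramMatrix_posDef hl τ k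
    have hw := hA.inv.posSemidef.dotProduct_mulVec_self_nonneg (visitCount (τ k))
    have hS : M.noiseSum τ (k + 1) = M.noiseSum τ k + M.noise (τ k) • visitCount (τ k) := by
      simp [FiniteMDP.noiseSum, Finset.sum_range_succ]
    rw [Finset.prod_range_succ, ih, Finset.prod_range_succ, hS, gramMatrix_succ,
      hA.quadForm_inv_add_vecMulVec, Real.sqrt_mul' _ (by linarith), selfNormalizedFactor,
      div_mul_div_comm, ← Real.exp_add]
    congr 2
    field_simp

variable [MeasurableSpace S] [MeasurableSpace A] [MeasurableSingletonClass S]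
  [MeasurableSingletonClass A]

lemma measurable_visitCount_dotProduct (v : S × A → ℝ) :
    Measurable fun t : Episode S A H => visitCount t ⬝ᵥ v := by
  unfold dotProduct
  exact Finset.measurable_sum _ fun z _ => (measurable_visitCount z).mul_const _

lemma FiniteMDP.measurable_noise (M : FiniteMDP S A) :
    Measurable (M.noise : Episode S A H → ℝ) :=
  measurable_cumReward.sub (measurable_visitCount_dotProduct _)

lemma FiniteMDP.lintegral_selfNormalizedFactor_le (M : FiniteMDP S A) (hH : 1 ≤ H)
    (π : DetPolicy S A H) (s₁ : S) [IsProbabilityMeasure (M.episodeLaw π s₁)]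
    {B : Matrix (S × A) (S × A) ℝ} (hB : B.PosSemidef) (v : S × A → ℝ) :
    ∫⁻ t, ENNReal.ofReal (selfNormalizedFactor ((H : ℝ) / 4) B v (visitCount t) (M.noise t))
      ∂(M.episodeLaw π s₁) ≤ 1 := by
  rw [episodeLaw_eq_sum, lintegral_finsetSum_measure]
  simp_rw [lintegral_smul_measure]
  refine (Finset.sum_le_sum (g := fun x => M.pathProb π s₁ x) fun x _ => ?_).trans
    (by rw [← M.episodeLaw_univ, measure_univ])
  set z : Fin H → S × A := fun h => (x h, π (x h) h)
  -- under the law given the visited pairs, the visit counts are deterministic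
  set d : S × A → ℝ := fun y => ∑ h, if z h = y then 1 else 0
  set η : Episode S A H → ℝ := fun t => ∑ h, (((t h).2 : ℝ) - M.meanReward (z h))
  have hη : Measurable η := Finset.measurable_sum _ fun h _ =>
    (measurable_subtype_coe.comp (measurable_pi_apply h).snd).sub_const _
  have hae : ∀ᵐ t ∂(M.rewardsLaw z),
      ENNReal.ofReal (selfNormalizedFactor ((H : ℝ) / 4) B v (visitCount t) (M.noise t)) =
        ENNReal.ofReal (selfNormalizedFactor ((H : ℝ) / 4) B v d (η t)) := by
    filter_upwards [M.ae_fst_eq_rewardsLaw z] with t ht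
    have h1 : visitCount t = d := by
      ext y; simp [visitCount, d, ht]
    have h2 : M.noise t = η t := by
      rw [noise, visitCount_dotProduct, cumReward, ← Finset.sum_sub_distrib]
      simp [η, ht]
    rw [h1, h2]
  rw [lintegral_congr_ae hae]
  have hle : ∫⁻ t, ENNReal.ofReal (selfNormalizedFactor ((H : ℝ) / 4) B v d (η t))
      ∂(M.rewardsLaw z) ≤ 1 := by
    have hH' : (0 : ℝ) < (H : ℝ) / 4 := by
      have : (0 : ℝ) < H := by exact_mod_cast hH
      positivity
    refine lintegral_exp_selfNormalized_le (M.rewardsLaw z) hη hH'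
      (fun θ => M.lintegral_exp_noise_rewardsLaw_le z θ) (hB.dotProduct_mulVec_self_nonneg d) ?_
    intro h0
    have := hB.abs_dotProduct_mulVec_le d v
    rw [matNorm, h0, Real.sqrt_zero, zero_mul] at this
    exact abs_nonpos_iff.1 this
  calc _ ≤ M.pathProb π s₁ x * 1 := by
        rw [smul_eq_mul]
        gcongr
    _ = _ := mul_one _

end Noise

section Occupancy

variable {S A : Type*} [Fintype S] [DecidableEq S] [DecidableEq A]
  [MeasurableSpace S] [MeasurableSpace A] [MeasurableSingletonClass S]
  [MeasurableSingletonClass A] {H : ℕ}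

lemma FiniteMDP.integrable_visitCount (M : FiniteMDP S A) (π : DetPolicy S A H) (s₁ : S)
    (z : S × A) : Integrable (fun t => visitCount t z) (M.episodeLaw π s₁) := by
  refine Integrable.of_bound (measurable_visitCount z).aestronglyMeasurable (H : ℝ)
    (ae_of_all _ fun t => ?_)
  rw [Real.norm_of_nonneg (visitCount_nonneg t z)]
  exact (Finset.sum_le_sum fun _ _ => by split_ifs <;> norm_num).trans
    (b := ∑ _h : Fin H, (1 : ℝ)) (by simp)

lemma FiniteMDP.integral_visitCount (M : FiniteMDP S A) (π : DetPolicy S A H) (s₁ : S)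
    (z : S × A) : ∫ t, visitCount t z ∂(M.episodeLaw π s₁) = M.avgOccupancy π s₁ z := by
  have hm : ∀ h : Fin H, MeasurableSet {t : Episode S A H | (t h).1 = z} := fun h =>
    (measurable_pi_apply h).fst (measurableSet_singleton z)
  have hi : ∀ h : Fin H, (fun t : Episode S A H => if (t h).1 = z then (1 : ℝ) else 0) =
      {t : Episode S A H | (t h).1 = z}.indicator fun _ => 1 := by
    intro h; ext t; simp [Set.indicator_apply]
  simp only [visitCount, avgOccupancy, occupancy]
  rw [integral_finsetSum]
  · simp_rw [hi]
    simp [integral_indicator_const, hm]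
  · intro h _
    rw [hi]
    exact (integrable_const _).indicator (hm h)

variable [Fintype A]

lemma FiniteMDP.integrable_visitCount_dotProduct (M : FiniteMDP S A) (π : DetPolicy S A H) (s₁ : S)
    (r : S × A → ℝ) : Integrable (fun t => visitCount t ⬝ᵥ r) (M.episodeLaw π s₁) :=
  integrable_finsetSum _ fun z _ => (M.integrable_visitCount π s₁ z).mul_const _

lemma FiniteMDP.integral_visitCount_dotProduct (M : FiniteMDP S A) (π : DetPolicy S A H) (s₁ : S)
    (r : S × A → ℝ) :
    ∫ t, visitCount t ⬝ᵥ r ∂(M.episodeLaw π s₁) = M.avgOccupancy π s₁ ⬝ᵥ r := by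
  simp only [dotProduct]
  rw [integral_finsetSum _ fun z _ => (M.integrable_visitCount π s₁ z).mul_const _]
  simp_rw [integral_mul_const, integral_visitCount]

lemma FiniteMDP.value_eq_dotProduct (M : FiniteMDP S A) (π : DetPolicy S A H) (s₁ : S) :
    M.value π s₁ = M.avgOccupancy π s₁ ⬝ᵥ M.meanReward := by
  rw [← integral_visitCount_dotProduct, value]
  simp_rw [visitCount_dotProduct]

/-- The exponential inequality behind the multiplicative comparison of the conditional means of the
squared widths with their realizations. It combines Jensen's inequality
`‖E d̂‖² ≤ E ‖d̂‖²` and `exp (-y) ≤ 1 - y / 2` on `[0, 1]`. -/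
lemma FiniteMDP.lintegral_exp_width_le (M : FiniteMDP S A) (π : DetPolicy S A H) (s₁ : S)
    [IsProbabilityMeasure (M.episodeLaw π s₁)] {B : Matrix (S × A) (S × A) ℝ} (hB : B.PosSemidef)
    {b : ℝ} (hb : 0 < b)
    (hbound : ∀ t : Episode S A H, visitCount t ⬝ᵥ (B *ᵥ visitCount t) ≤ b) :
    ∫⁻ t, ENNReal.ofReal (Real.exp
      (M.avgOccupancy π s₁ ⬝ᵥ (B *ᵥ M.avgOccupancy π s₁) / (2 * b) -
        visitCount t ⬝ᵥ (B *ᵥ visitCount t) / b)) ∂(M.episodeLaw π s₁) ≤ 1 := by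
  set d := M.avgOccupancy π s₁
  set q := d ⬝ᵥ (B *ᵥ d)
  -- the tangent to the convex function `‖·‖²_B` at the mean `d`; it is affine in the visit counts
  have hlow : ∀ t : Episode S A H,
      2 * (visitCount t ⬝ᵥ (B *ᵥ d)) - q ≤ visitCount t ⬝ᵥ (B *ᵥ visitCount t) := by
    intro t
    have h1 := hB.dotProduct_mulVec_self_nonneg (visitCount t - d)
    have h2 := hB.isHermitian.dotProduct_mulVec_comm d (visitCount t)
    simp only [mulVec_sub, sub_dotProduct, dotProduct_sub, h2] at h1
    linarith
  have hpt : ∀ t : Episode S A H, Real.exp (q / (2 * b) - visitCount t ⬝ᵥ (B *ᵥ visitCount t) / b) ≤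
      Real.exp (q / (2 * b)) * (1 + q / (2 * b) - visitCount t ⬝ᵥ (B *ᵥ d) / b) := by
    intro t
    rw [sub_eq_add_neg, Real.exp_add]
    gcongr
    set y := visitCount t ⬝ᵥ (B *ᵥ visitCount t) / b with hy
    have hy0 : 0 ≤ y := div_nonneg (hB.dotProduct_mulVec_self_nonneg _) hb.le
    have hy1 : y ≤ 1 := (div_le_one hb).2 (hbound t)
    have h1 : Real.exp (-y) ≤ 1 - y / 2 := by
      -- `exp y ≥ 1 + y` and `(1 + y) (1 - y / 2) ≥ 1`
      rw [Real.exp_neg]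
      refine inv_le_of_inv_le₀ (by linarith) ((inv_le_of_inv_le₀ (by positivity) ?_).trans
        (Real.add_one_le_exp y))
      rw [inv_le_comm₀ (by positivity) (by linarith), inv_le_iff_one_le_mul₀ (by linarith)]
      nlinarith
    have h2 : visitCount t ⬝ᵥ (B *ᵥ d) / b - q / (2 * b) ≤ y / 2 := by
      have : visitCount t ⬝ᵥ (B *ᵥ d) / b - q / (2 * b) =
          (2 * (visitCount t ⬝ᵥ (B *ᵥ d)) - q) / (2 * b) := by field_simp
      rw [this, hy, div_div, mul_comm b 2]
      gcongr
      exact hlow t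
    linarith
  have hdiv := (M.integrable_visitCount_dotProduct π s₁ (B *ᵥ d)).div_const b
  have hint : Integrable (fun t : Episode S A H =>
      1 + q / (2 * b) - visitCount t ⬝ᵥ (B *ᵥ d) / b) (M.episodeLaw π s₁) :=
    (integrable_const _).sub hdiv
  have hmean : ∫ t, (1 + q / (2 * b) - visitCount t ⬝ᵥ (B *ᵥ d) / b) ∂(M.episodeLaw π s₁) =
      1 - q / (2 * b) := by
    rw [integral_sub (integrable_const _) hdiv, integral_div, integral_visitCount_dotProduct]
    simp only [integral_const, probReal_univ, one_smul]
    change 1 + q / (2 * b) - q / b = 1 - q / (2 * b)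
    field_simp
    ring
  calc _ ≤ ∫⁻ t, ENNReal.ofReal (Real.exp (q / (2 * b)) *
          (1 + q / (2 * b) - visitCount t ⬝ᵥ (B *ᵥ d) / b)) ∂(M.episodeLaw π s₁) :=
        lintegral_mono fun t => ENNReal.ofReal_le_ofReal (hpt t)
    _ = ENNReal.ofReal (Real.exp (q / (2 * b)) * (1 - q / (2 * b))) := by
        rw [← ofReal_integral_eq_lintegral_ofReal (hint.const_mul _)
          (ae_of_all _ fun t => (Real.exp_pos _).le.trans (hpt t)), integral_const_mul, hmean]
    _ ≤ 1 := by
        rw [ENNReal.ofReal_le_one]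
        calc _ ≤ Real.exp (q / (2 * b)) * Real.exp (-(q / (2 * b))) := by
              gcongr; linarith [Real.add_one_le_exp (-(q / (2 * b)))]
          _ = 1 := by rw [← Real.exp_add]; simp

end Occupancy

/-! ### Supermartingales along the interaction -/

section InteractionProcess

open scoped ENNReal

variable {S A : Type*} [Fintype S] [DecidableEq S] [MeasurableSpace S] [MeasurableSpace A]
  {H : ℕ} {Ω : Type*} {mΩ : MeasurableSpace Ω} {μ : Measure Ω}
  {F : Filtration ℕ mΩ} {M : FiniteMDP S A} {s₁ : ℕ → Ω → S}
  {π : ℕ → Ω → DetPolicy S A H} {τ : ℕ → Ω → Episode S A H}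

lemma IsInteraction.measurable_episode_of_lt (h : IsInteraction μ F M s₁ π τ) {l k : ℕ}
    (hlk : l < k) : Measurable[F k] (τ l) :=
  (h.measurable_episode l).mono (F.mono hlk) le_rfl

variable [IsProbabilityMeasure μ]

/-- That the episode law has mass one follows from the conditional law of the whole space. -/
lemma IsInteraction.ae_isProbabilityMeasure (h : IsInteraction μ F M s₁ π τ) (k : ℕ) :
    ∀ᵐ ω ∂μ, IsProbabilityMeasure (M.episodeLaw (π k ω) (s₁ k ω)) := by
  have h1 := h.condLaw k Set.univ MeasurableSet.univ
  rw [Set.preimage_univ, Set.indicator_univ, condExp_const (F.le k)] at h1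
  filter_upwards [h1] with ω hω
  constructor
  rw [← ENNReal.toReal_eq_one_iff]
  exact hω.symm

variable [Fintype A] [MeasurableSingletonClass S] [MeasurableSingletonClass A]

/-- A product of functions of the past and the current episode, each with conditional mean at most
one, is a nonnegative supermartingale; hence it exceeds `c` at some time with probability at most
`1 / c`. -/
lemma IsInteraction.mul_measure_exists_le_prod (h : IsInteraction μ F M s₁ π τ)
    {f : ℕ → Ω → Episode S A H → ℝ≥0∞}
    (hf : ∀ k, Measurable[(F k).prod inferInstance] (Function.uncurry (f k)))
    (hle : ∀ k ω, IsProbabilityMeasure (M.episodeLaw (π k ω) (s₁ k ω)) →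
      ∫⁻ t, f k ω t ∂(M.episodeLaw (π k ω) (s₁ k ω)) ≤ 1) (c : ℝ≥0∞) :
    c * μ {ω | ∃ k, c ≤ ∏ l ∈ Finset.range k, f l ω (τ l ω)} ≤ 1 := by
  have hX : ∀ k, Measurable[F k] fun ω => ∏ l ∈ Finset.range k, f l ω (τ l ω) := by
    intro k
    refine Finset.measurable_fun_prod _ fun l hl => ?_
    have hlk : l < k := Finset.mem_range.1 hl
    have h1 : @Measurable Ω (Ω × Episode S A H) (F k) ((F l).prod inferInstance)
        fun ω => (ω, τ l ω) :=
      Measurable.prodMk (measurable_id'' (F.mono hlk.le)) (h.measurable_episode_of_lt hlk)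
    exact (hf l).comp h1
  have hmain := mul_measure_exists_le_lintegral μ F hX (fun k E hE => ?_) c
  · simpa using hmain
  have hg : Measurable[F k] fun ω => (π k ω, s₁ k ω) :=
    (h.measurable_policy k).prodMk (h.measurable_init k)
  let κ : @Kernel Ω (Episode S A H) (F k) _ :=
    @Kernel.comap _ _ _ _ Ω (F k) (M.episodeKernel H) _ hg
  have hκfin : @IsFiniteKernel Ω (Episode S A H) (F k) _ κ :=
    ⟨Fintype.card (Fin H → S), ENNReal.natCast_lt_top _, fun _ => M.episodeLaw_univ_le _ _⟩
  have hτ : Measurable[mΩ] (τ k) := (h.measurable_episode k).mono (F.le _) le_rfl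
  set X : Ω → ℝ≥0∞ := fun ω => ∏ l ∈ Finset.range k, f l ω (τ l ω) with hXdef
  -- the event `E` and the past factors are known before episode `k`, so that they pass through the
  -- integral over the episode
  have hgm : Measurable[(F k).prod inferInstance] (Function.uncurry fun ω t =>
      E.indicator X ω * f k ω t) :=
    (((hX k).indicator hE).comp (@measurable_fst _ _ (F k) _)).mul (hf k)
  have hE' := F.le k _ hE
  calc ∫⁻ ω in E, ∏ l ∈ Finset.range (k + 1), f l ω (τ l ω) ∂μ
      = ∫⁻ ω, E.indicator X ω * f k ω (τ k ω) ∂μ := by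
        rw [← lintegral_indicator hE']
        refine lintegral_congr fun ω => ?_
        by_cases hω : ω ∈ E
        · simp [hω, hXdef, Finset.prod_range_succ]
        · simp [hω]
    _ = ∫⁻ ω, ∫⁻ t, E.indicator X ω * f k ω t ∂(κ ω) ∂μ :=
        lintegral_eq_lintegral_lintegral_of_condLaw (F.le k) κ hτ (h.condLaw k) hgm
    _ ≤ ∫⁻ ω, E.indicator X ω ∂μ := by
        refine lintegral_mono_ae ?_
        filter_upwards [h.ae_isProbabilityMeasure k] with ω hω
        have hfω : Measurable (f k ω) := (hf k).comp (@measurable_prodMk_left _ _ (F k) _ ω)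
        rw [lintegral_const_mul _ hfω]
        exact mul_le_of_le_one_right' (hle k ω hω)
    _ = ∫⁻ ω in E, X ω ∂μ := lintegral_indicator hE' _

end InteractionProcess

section ProcessMeasurability

lemma Measurable.matrix_inv_apply {Ω n : Type*} [Fintype n] [DecidableEq n] {m : MeasurableSpace Ω}
    {B : Ω → Matrix n n ℝ} (hB : ∀ i j, Measurable fun ω => B ω i j) (i j : n) :
    Measurable fun ω => (B ω)⁻¹ i j := by
  have hdet : ∀ C : Ω → Matrix n n ℝ, (∀ i j, Measurable fun ω => C ω i j) →
      Measurable fun ω => (C ω).det := by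
    intro C hC
    simp only [det_apply]
    exact Finset.measurable_sum _ fun σ _ =>
      (Finset.measurable_fun_prod _ fun i _ => hC _ _).const_smul _
  simp only [inv_def, Matrix.smul_apply, smul_eq_mul, Ring.inverse_eq_inv', adjugate_apply]
  refine (hdet B hB).inv.mul (hdet _ fun a b => ?_)
  simp only [updateRow_apply]
  split_ifs
  · exact measurable_const
  · exact hB a b

lemma Measurable.dotProduct_mulVec {Ω n : Type*} [Fintype n] {m : MeasurableSpace Ω}
    {B : Ω → Matrix n n ℝ} {x y : Ω → n → ℝ} (hB : ∀ i j, Measurable fun ω => B ω i j)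
    (hx : ∀ i, Measurable fun ω => x ω i) (hy : ∀ i, Measurable fun ω => y ω i) :
    Measurable fun ω => x ω ⬝ᵥ (B ω *ᵥ y ω) := by
  unfold Matrix.mulVec dotProduct
  exact Finset.measurable_sum _ fun i _ => (hx i).mul <|
    Finset.measurable_sum _ fun j _ => (hB i j).mul (hy j)

lemma measurable_selfNormalizedFactor {Ω n : Type*} [Fintype n] {m : MeasurableSpace Ω} (a : ℝ)
    {B : Ω → Matrix n n ℝ} {v d : Ω → n → ℝ} {η : Ω → ℝ} (hB : ∀ i j, Measurable fun ω => B ω i j)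
    (hv : ∀ i, Measurable fun ω => v ω i) (hd : ∀ i, Measurable fun ω => d ω i)
    (hη : Measurable η) :
    Measurable fun ω => selfNormalizedFactor a (B ω) (v ω) (d ω) (η ω) := by
  have h1 := Measurable.dotProduct_mulVec hB hd hv
  have h2 := Measurable.dotProduct_mulVec hB hd hd
  unfold selfNormalizedFactor
  fun_prop

lemma measurable_exp_quadForm_sub_quadForm {Ω n : Type*} [Fintype n] {m : MeasurableSpace Ω}
    (a b : ℝ) {B : Ω → Matrix n n ℝ} {x y : Ω → n → ℝ} (hB : ∀ i j, Measurable fun ω => B ω i j)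
    (hx : ∀ i, Measurable fun ω => x ω i) (hy : ∀ i, Measurable fun ω => y ω i) :
    Measurable fun ω => Real.exp (x ω ⬝ᵥ (B ω *ᵥ x ω) / a - y ω ⬝ᵥ (B ω *ᵥ y ω) / b) := by
  have h1 := Measurable.dotProduct_mulVec hB hx hx
  have h2 := Measurable.dotProduct_mulVec hB hy hy
  fun_prop

variable {S A : Type*} [Fintype S] [Fintype A] [DecidableEq S] [DecidableEq A]
  [MeasurableSpace S] [MeasurableSpace A] [MeasurableSingletonClass S]
  [MeasurableSingletonClass A] {H : ℕ} {Ω : Type*} {m : MeasurableSpace Ω}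
  {τ : ℕ → Ω → Episode S A H} {k : ℕ}

lemma measurable_gramMatrix_inv_apply (lam : ℝ) (hτ : ∀ l < k, Measurable (τ l)) (i j : S × A) :
    Measurable fun ω => (gramMatrix lam (fun l => τ l ω) k)⁻¹ i j := by
  refine Measurable.matrix_inv_apply (fun i j => ?_) i j
  simp only [gramMatrix, Matrix.add_apply, Matrix.sum_apply, vecMulVec_apply]
  exact measurable_const.add <| Finset.measurable_sum _ fun l hl =>
    ((measurable_visitCount i).comp (hτ l (Finset.mem_range.1 hl))).mul
      ((measurable_visitCount j).comp (hτ l (Finset.mem_range.1 hl)))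

lemma measurable_noiseSum_apply (M : FiniteMDP S A) (hτ : ∀ l < k, Measurable (τ l)) (i : S × A) :
    Measurable fun ω => M.noiseSum (fun l => τ l ω) k i := by
  simp only [FiniteMDP.noiseSum, Finset.sum_apply, Pi.smul_apply, smul_eq_mul]
  exact Finset.measurable_sum _ fun l hl =>
    (M.measurable_noise.comp (hτ l (Finset.mem_range.1 hl))).mul
      ((measurable_visitCount i).comp (hτ l (Finset.mem_range.1 hl)))

end ProcessMeasurability

section HighProbability

open scoped ENNReal

variable {S A : Type*} [Fintype S] [Fintype A] [DecidableEq S] [DecidableEq A]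
  [MeasurableSpace S] [MeasurableSpace A] [MeasurableSingletonClass S]
  [MeasurableSingletonClass A] {H : ℕ} {Ω : Type*} {mΩ : MeasurableSpace Ω} {μ : Measure Ω}
  [IsProbabilityMeasure μ] {F : Filtration ℕ mΩ} {M : FiniteMDP S A} {s₁ : ℕ → Ω → S}
  {π : ℕ → Ω → DetPolicy S A H} {τ : ℕ → Ω → Episode S A H}

/-- The self-normalized concentration inequality, uniformly over the episodes. -/
lemma IsInteraction.mul_measure_exists_le_selfNormalized (h : IsInteraction μ F M s₁ π τ)
    (hH : 1 ≤ H) {lam : ℝ} (hl : 0 < lam) (c : ℝ) :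
    ENNReal.ofReal c * μ {ω | ∃ k, c ≤ ∏ l ∈ Finset.range k,
      selfNormalizedFactor ((H : ℝ) / 4) (gramMatrix lam (fun i => τ i ω) l)⁻¹
        (M.noiseSum (fun i => τ i ω) l) (visitCount (τ l ω)) (M.noise (τ l ω))} ≤ 1 := by
  have key := h.mul_measure_exists_le_prod (f := fun l ω t => ENNReal.ofReal
    (selfNormalizedFactor ((H : ℝ) / 4) (gramMatrix lam (fun i => τ i ω) l)⁻¹
        (M.noiseSum (fun i => τ i ω) l) (visitCount t) (M.noise t))) (fun k => ?_)
    (fun k ω hω => M.lintegral_selfNormalizedFactor_le hH _ _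
      (gramMatrix_posDef hl _ _).inv.posSemidef _) (ENNReal.ofReal c)
  · refine le_trans ?_ key
    gcongr with ω k
    intro hk
    rw [← ENNReal.ofReal_prod_of_nonneg fun l _ => selfNormalizedFactor_nonneg _ _ _ _ _]
    exact ENNReal.ofReal_le_ofReal hk
  · have hτ : ∀ l < k, Measurable[F k] (τ l) := fun l hlk => h.measurable_episode_of_lt hlk
    have hfst : @Measurable (Ω × Episode S A H) Ω ((F k).prod inferInstance) (F k) Prod.fst :=
      @measurable_fst _ _ (F k) _
    have hsnd : Measurable[(F k).prod inferInstance] (Prod.snd : Ω × Episode S A H → _) :=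
      @measurable_snd _ _ (F k) _
    refine ENNReal.measurable_ofReal.comp (measurable_selfNormalizedFactor _
      (fun i j => (measurable_gramMatrix_inv_apply lam hτ i j).comp hfst)
      (fun i => (measurable_noiseSum_apply M hτ i).comp hfst)
      (fun i => (measurable_visitCount i).comp hsnd) (M.measurable_noise.comp hsnd))

/-- The squared widths of the expected visit counts are dominated by those of the observed ones,
uniformly over the episodes. -/
lemma IsInteraction.mul_measure_exists_le_widths (h : IsInteraction μ F M s₁ π τ)
    (hH : 1 ≤ H) (c : ℝ) :
    ENNReal.ofReal (Real.exp c) * μ {ω | ∃ k, c ≤ ∑ l ∈ Finset.range k,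
      (M.avgOccupancy (π l ω) (s₁ l ω) ⬝ᵥ ((gramMatrix (H : ℝ) (fun i => τ i ω) l)⁻¹ *ᵥ
          M.avgOccupancy (π l ω) (s₁ l ω)) / (2 * H) -
        visitCount (τ l ω) ⬝ᵥ ((gramMatrix (H : ℝ) (fun i => τ i ω) l)⁻¹ *ᵥ
          visitCount (τ l ω)) / H)} ≤ 1 := by
  have hH0 : (0 : ℝ) < H := by exact_mod_cast hH
  have key := h.mul_measure_exists_le_prod (f := fun l ω t => ENNReal.ofReal (Real.exp
      (M.avgOccupancy (π l ω) (s₁ l ω) ⬝ᵥ ((gramMatrix (H : ℝ) (fun i => τ i ω) l)⁻¹ *ᵥ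
          M.avgOccupancy (π l ω) (s₁ l ω)) / (2 * H) -
        visitCount t ⬝ᵥ ((gramMatrix (H : ℝ) (fun i => τ i ω) l)⁻¹ *ᵥ visitCount t) / H)))
    (fun k => ?_)
    (fun k ω hω => M.lintegral_exp_width_le _ _ (gramMatrix_posDef hH0 _ _).inv.posSemidef hH0
      fun t => ?_) (ENNReal.ofReal (Real.exp c))
  · refine le_trans ?_ key
    gcongr with ω k
    intro hk
    rw [← ENNReal.ofReal_prod_of_nonneg fun l _ => (Real.exp_pos _).le, ← Real.exp_sum]
    exact ENNReal.ofReal_le_ofReal (Real.exp_le_exp.2 hk)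
  · have hτ : ∀ l < k, Measurable[F k] (τ l) := fun l hlk => h.measurable_episode_of_lt hlk
    have hfst : @Measurable (Ω × Episode S A H) Ω ((F k).prod inferInstance) (F k) Prod.fst :=
      @measurable_fst _ _ (F k) _
    have hsnd : Measurable[(F k).prod inferInstance] (Prod.snd : Ω × Episode S A H → _) :=
      @measurable_snd _ _ (F k) _
    have hg : Measurable[F k] fun ω => (π k ω, s₁ k ω) :=
      (h.measurable_policy k).prodMk (h.measurable_init k)
    have hfin : ∀ φ : DetPolicy S A H × S → ℝ, Measurable[(F k).prod inferInstance]
        fun p : Ω × Episode S A H => φ (π k p.1, s₁ k p.1) :=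
      fun φ => (measurable_of_finite φ).comp (hg.comp hfst)
    have hB : ∀ i j, Measurable[(F k).prod inferInstance] fun p : Ω × Episode S A H =>
        (gramMatrix (H : ℝ) (fun l => τ l p.1) k)⁻¹ i j :=
      fun i j => (measurable_gramMatrix_inv_apply (H : ℝ) hτ i j).comp hfst
    have hv : ∀ i, Measurable[(F k).prod inferInstance]
        fun p : Ω × Episode S A H => visitCount p.2 i :=
      fun i => (measurable_visitCount i).comp hsnd
    have hd : ∀ i, Measurable[(F k).prod inferInstance]
        fun p : Ω × Episode S A H => M.avgOccupancy (π k p.1) (s₁ k p.1) i :=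
      fun i => hfin fun q => M.avgOccupancy q.1 q.2 i
    exact ENNReal.measurable_ofReal.comp (measurable_exp_quadForm_sub_quadForm _ _ hB hd hv)
  · refine (quadForm_gramMatrix_inv_le hH0 _ _ _).trans ?_
    rw [div_le_iff₀ hH0, ← sq]
    exact visitCount_dotProduct_self_le t

end HighProbability

/-! ### Confidence ellipsoid, optimism and the regret bound -/

section Confidence

/-- The confidence width before episode `k < K`, as `log 10 ≤ 4 log 2 ≤ 4 L` and `1 + k H ≤ K H`,
for `L = log (K H / δ)`. -/
lemma confWidth_le {S A : Type*} [Fintype S] [Fintype A] {H : ℕ} (hH : 1 ≤ H) {δ : ℝ}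
    (hδ : 0 < δ) {k K : ℕ} (hk : k < K) (hL : 2 ≤ (K : ℝ) * (H : ℝ) / δ) :
    confWidth S A H H δ k ≤ 3 * √((Fintype.card S : ℝ) * (Fintype.card A : ℝ) * H *
      Real.log ((K : ℝ) * (H : ℝ) / δ)) := by
  set n := (Fintype.card S : ℝ) * (Fintype.card A : ℝ) with hn_def
  have hn0 : 0 ≤ n := by positivity
  set L := Real.log ((K : ℝ) * (H : ℝ) / δ) with hL_def
  have hH1 : (1 : ℝ) ≤ H := by exact_mod_cast hH
  have hH0 : (0 : ℝ) < H := by linarith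
  have hK : (k : ℝ) + 1 ≤ K := by exact_mod_cast hk
  have hk0 : (0 : ℝ) ≤ k := by positivity
  have hL2 : Real.log 2 ≤ L := Real.log_le_log (by norm_num) hL
  have hl2 := Real.log_two_gt_d9
  have hlog10 : Real.log 10 ≤ 4 * Real.log 2 := by
    have : Real.log 10 ≤ Real.log (2 ^ 4) := Real.log_le_log (by norm_num) (by norm_num)
    rw [Real.log_pow] at this
    exact_mod_cast this
  have hlog : Real.log ((1 + (k : ℝ) * (H : ℝ) ^ 2 / H) / (δ / 10)) ≤ 5 * L := by
    have h1 : (1 + (k : ℝ) * (H : ℝ) ^ 2 / H) / (δ / 10) ≤ 10 * ((K : ℝ) * (H : ℝ) / δ) := by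
      rw [show (1 + (k : ℝ) * (H : ℝ) ^ 2 / H) / (δ / 10) = 10 * ((1 + k * H) / δ) by field_simp]
      gcongr
      nlinarith
    have h2 := Real.log_le_log (by positivity) h1
    rw [Real.log_mul (by norm_num) (by positivity)] at h2
    linarith
  have hL0 : 0 ≤ L := by linarith
  -- each of the two summands of the width is at most half of the bound
  have e : ∀ x : ℝ, 0 ≤ x → √(9 / 4 * x) = 3 / 2 * √x := by
    intro x hx
    rw [Real.sqrt_mul (by norm_num), show (9 / 4 : ℝ) = (3 / 2) ^ 2 by norm_num,
      Real.sqrt_sq (by norm_num)]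
  have hx : 0 ≤ n * H * L := by positivity
  have hnH : 0 ≤ n * H := by positivity
  have h1 : √((1 / 4) * (Fintype.card S : ℝ) * (Fintype.card A : ℝ) * (H : ℝ) *
      Real.log ((1 + (k : ℝ) * (H : ℝ) ^ 2 / H) / (δ / 10))) ≤ 3 / 2 * √(n * H * L) := by
    rw [← e _ hx]
    apply Real.sqrt_le_sqrt
    calc _ = 1 / 4 * (n * H) * Real.log ((1 + (k : ℝ) * (H : ℝ) ^ 2 / H) / (δ / 10)) := by
          rw [hn_def]; ring
      _ ≤ 1 / 4 * (n * H) * (5 * L) := by gcongr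
      _ ≤ _ := by linarith
  have h2 : √((H : ℝ) * (Fintype.card S : ℝ) * (Fintype.card A : ℝ)) ≤ 3 / 2 * √(n * H * L) := by
    rw [← e _ hx]
    apply Real.sqrt_le_sqrt
    rw [mul_assoc, ← hn_def]
    nlinarith
  rw [confWidth]
  linarith

variable {S A : Type*} [Fintype S] [Fintype A] [DecidableEq S] [DecidableEq A] {H : ℕ}

/-- Since `V̂ = ⟨d̂, r⟩ + η`, the response vector is `S + (A - lam) r`: the true mean reward solves
the normal equations up to the noise `S` and the regularization bias `lam r`. -/
lemma responseVec_eq (M : FiniteMDP S A) (lam : ℝ) (τ : ℕ → Episode S A H) (k : ℕ) :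
    responseVec τ k =
      M.noiseSum τ k + (gramMatrix lam τ k *ᵥ M.meanReward - lam • M.meanReward) := by
  induction k with
  | zero => simp [responseVec, FiniteMDP.noiseSum, gramMatrix_zero, smul_mulVec]
  | succ k ih =>
    have h1 : responseVec τ (k + 1) = responseVec τ k + cumReward (τ k) • visitCount (τ k) := by
      simp [responseVec, Finset.sum_range_succ]
    have h2 : M.noiseSum τ (k + 1) = M.noiseSum τ k + M.noise (τ k) • visitCount (τ k) := by
      simp [FiniteMDP.noiseSum, Finset.sum_range_succ]
    rw [h1, h2, ih, gramMatrix_succ, add_mulVec, vecMulVec_mulVec, op_smul_eq_smul,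
      FiniteMDP.noise, sub_smul]
    abel

lemma lsEstimator_sub_meanReward (M : FiniteMDP S A) {lam : ℝ} (hl : 0 < lam)
    (τ : ℕ → Episode S A H) (k : ℕ) :
    lsEstimator lam τ k - M.meanReward =
      (gramMatrix lam τ k)⁻¹ *ᵥ M.noiseSum τ k -
        lam • ((gramMatrix lam τ k)⁻¹ *ᵥ M.meanReward) := by
  have hdet : IsUnit (gramMatrix lam τ k).det :=
    (gramMatrix lam τ k).isUnit_iff_isUnit_det.1 (gramMatrix_posDef hl τ k).isUnit
  rw [lsEstimator, responseVec_eq M lam τ k, mulVec_add, mulVec_sub, mulVec_mulVec,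
    nonsing_inv_mul _ hdet, one_mulVec, mulVec_smul]
  abel

lemma matNorm_gramMatrix_inv_meanReward_le (M : FiniteMDP S A) {lam : ℝ} (hl : 0 < lam)
    (τ : ℕ → Episode S A H) (k : ℕ) :
    lam * matNorm (gramMatrix lam τ k)⁻¹ M.meanReward ≤
      √(lam * (Fintype.card S : ℝ) * (Fintype.card A : ℝ)) := by
  have hr : M.meanReward ⬝ᵥ M.meanReward ≤ (Fintype.card S : ℝ) * (Fintype.card A : ℝ) := by
    calc M.meanReward ⬝ᵥ M.meanReward ≤ ∑ _z : S × A, (1 : ℝ) :=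
          Finset.sum_le_sum fun z _ => mul_le_one₀ (M.meanReward_mem_Icc z).2
            (M.meanReward_mem_Icc z).1 (M.meanReward_mem_Icc z).2
      _ = _ := by simp
  apply Real.le_sqrt_of_sq_le
  rw [mul_pow, (gramMatrix_posDef hl τ k).inv.posSemidef.matNorm_sq]
  have h := (quadForm_gramMatrix_inv_le hl τ k M.meanReward).trans
    (div_le_div_of_nonneg_right hr hl.le)
  calc _ ≤ lam ^ 2 * ((Fintype.card S : ℝ) * (Fintype.card A : ℝ) / lam) := by gcongr
    _ = _ := by field_simp

/-- On the event of the self-normalized inequality, the noise term is bounded by the first summand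
of the confidence width. Absorbing `2 log (10 / δ)` into `SA log (10 / δ)` needs `2 ≤ SA`. -/
lemma matNorm_noiseSum_le (M : FiniteMDP S A) (hH : 1 ≤ H) {lam δ : ℝ} (hl : 0 < lam) (hδ : 0 < δ)
    (hδ1 : δ < 1) (hn : 2 ≤ Fintype.card S * Fintype.card A) (τ : ℕ → Episode S A H) (k : ℕ)
    (h : ∏ l ∈ Finset.range k, selfNormalizedFactor ((H : ℝ) / 4) (gramMatrix lam τ l)⁻¹
        (M.noiseSum τ l) (visitCount (τ l)) (M.noise (τ l)) < 10 / δ) :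
    matNorm (gramMatrix lam τ k)⁻¹ (M.noiseSum τ k) ≤
      √((1 / 4) * (Fintype.card S : ℝ) * (Fintype.card A : ℝ) * (H : ℝ) *
        Real.log ((1 + (k : ℝ) * (H : ℝ) ^ 2 / lam) / (δ / 10))) := by
  have hH0 : (0 : ℝ) < H := by exact_mod_cast hH
  rw [matNorm]
  apply Real.sqrt_le_sqrt
  rw [prod_selfNormalizedFactor hl (by positivity)] at h
  set q := M.noiseSum τ k ⬝ᵥ ((gramMatrix lam τ k)⁻¹ *ᵥ M.noiseSum τ k)
  set P := ∏ l ∈ Finset.range k,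
    (1 + visitCount (τ l) ⬝ᵥ ((gramMatrix lam τ l)⁻¹ *ᵥ visitCount (τ l))) with hP_def
  have hP : 0 < P := Finset.prod_pos fun l _ => by
    linarith [(gramMatrix_posDef hl τ l).inv.posSemidef.dotProduct_mulVec_self_nonneg
      (visitCount (τ l))]
  set G := 1 + (k : ℝ) * (H : ℝ) ^ 2 / lam with hG_def
  have hG : 0 < G := by positivity
  have hlogP : Real.log P ≤ (Fintype.card S : ℝ) * (Fintype.card A : ℝ) * Real.log G := by
    have := Real.log_le_log hP (prod_one_add_width_le hl τ k)
    rw [Real.log_pow] at this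
    push_cast at this
    exact this
  have hD : 0 ≤ Real.log (10 / δ) := Real.log_nonneg (by rw [le_div_iff₀ hδ]; linarith)
  have h1 : q / (2 * ((H : ℝ) / 4)) < Real.log (10 / δ) + Real.log P / 2 := by
    rw [div_lt_iff₀ (Real.sqrt_pos.2 hP)] at h
    have h2 := Real.log_lt_log (Real.exp_pos _) h
    rwa [Real.log_exp, Real.log_mul (by positivity) (Real.sqrt_pos.2 hP).ne',
      Real.log_sqrt hP.le] at h2
  have hlog : Real.log (G / (δ / 10)) = Real.log G + Real.log (10 / δ) := by
    rw [← Real.log_mul hG.ne' (by positivity)]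
    congr 1
    field_simp
  have hn' : (2 : ℝ) ≤ (Fintype.card S : ℝ) * (Fintype.card A : ℝ) := by exact_mod_cast hn
  rw [hlog]
  have h3 : 2 * Real.log (10 / δ) ≤
      (Fintype.card S : ℝ) * (Fintype.card A : ℝ) * Real.log (10 / δ) := by gcongr
  rw [div_lt_iff₀ (by positivity)] at h1
  calc q ≤ (H : ℝ) / 4 * (2 * Real.log (10 / δ) + Real.log P) := by linarith
    _ ≤ (H : ℝ) / 4 * ((Fintype.card S : ℝ) * (Fintype.card A : ℝ) * Real.log (10 / δ) +
          (Fintype.card S : ℝ) * (Fintype.card A : ℝ) * Real.log G) := by gcongr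
    _ = _ := by ring

/-- The confidence ellipsoid: the estimated value of every direction `d` is accurate up to the
confidence width times the norm of `d`. -/
lemma abs_dotProduct_lsEstimator_sub_le (M : FiniteMDP S A) (hH : 1 ≤ H) {lam δ : ℝ} (hl : 0 < lam)
    (hδ : 0 < δ) (hδ1 : δ < 1) (hn : 2 ≤ Fintype.card S * Fintype.card A)
    (τ : ℕ → Episode S A H) (k : ℕ)
    (h : ∏ l ∈ Finset.range k, selfNormalizedFactor ((H : ℝ) / 4) (gramMatrix lam τ l)⁻¹
        (M.noiseSum τ l) (visitCount (τ l)) (M.noise (τ l)) < 10 / δ) (d : S × A → ℝ) :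
    |d ⬝ᵥ lsEstimator lam τ k - d ⬝ᵥ M.meanReward| ≤
      confWidth S A H lam δ k * matNorm (gramMatrix lam τ k)⁻¹ d := by
  have hB := (gramMatrix_posDef hl τ k).inv.posSemidef
  have h1 := hB.abs_dotProduct_mulVec_le d (M.noiseSum τ k)
  have h2 := hB.abs_dotProduct_mulVec_le d M.meanReward
  have h3 := matNorm_noiseSum_le M hH hl hδ hδ1 hn τ k h
  have h4 := matNorm_gramMatrix_inv_meanReward_le M hl τ k
  have hd := matNorm_nonneg (gramMatrix lam τ k)⁻¹ d
  rw [← dotProduct_sub, lsEstimator_sub_meanReward M hl, dotProduct_sub, dotProduct_smul,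
    smul_eq_mul, confWidth]
  calc _ ≤ |d ⬝ᵥ ((gramMatrix lam τ k)⁻¹ *ᵥ M.noiseSum τ k)| +
        |lam * (d ⬝ᵥ ((gramMatrix lam τ k)⁻¹ *ᵥ M.meanReward))| := abs_sub _ _
    _ ≤ matNorm (gramMatrix lam τ k)⁻¹ d * matNorm (gramMatrix lam τ k)⁻¹ (M.noiseSum τ k) +
        lam * (matNorm (gramMatrix lam τ k)⁻¹ d *
          matNorm (gramMatrix lam τ k)⁻¹ M.meanReward) := by
        rw [abs_mul, abs_of_pos hl]
        gcongr
    _ = (matNorm (gramMatrix lam τ k)⁻¹ (M.noiseSum τ k) +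
          lam * matNorm (gramMatrix lam τ k)⁻¹ M.meanReward) *
        matNorm (gramMatrix lam τ k)⁻¹ d := by ring
    _ ≤ _ := by gcongr

lemma div_le_two_mul_log_one_add {b w : ℝ} (hb : 1 ≤ b) (hw : 0 ≤ w) (hwb : w ≤ b) :
    w / b ≤ 2 * Real.log (1 + w) := by
  rcases le_total w 1 with h | h
  · have h1 := Real.one_sub_inv_le_log_of_pos (show 0 < 1 + w by linarith)
    -- `log (1 + w) ≥ w / (1 + w) ≥ w / 2` for `w ≤ 1`
    have h2 : w / 2 ≤ 1 - (1 + w)⁻¹ := by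
      rw [show 1 - (1 + w)⁻¹ = w / (1 + w) by field_simp; ring]
      gcongr
      linarith
    have h3 : w / b ≤ w := div_le_self hw hb
    linarith
  · have h1 : w / b ≤ 1 := (div_le_one (by linarith)).2 hwb
    have h2 : Real.log 2 ≤ Real.log (1 + w) := Real.log_le_log (by norm_num) (by linarith)
    linarith [Real.log_two_gt_d9]

/-- The elliptical potential lemma. -/
lemma sum_width_div_le (hH : 1 ≤ H) (τ : ℕ → Episode S A H) (K : ℕ) :
    ∑ l ∈ Finset.range K, visitCount (τ l) ⬝ᵥ
        ((gramMatrix (H : ℝ) τ l)⁻¹ *ᵥ visitCount (τ l)) / H ≤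
      2 * ((Fintype.card S : ℝ) * (Fintype.card A : ℝ) * Real.log (1 + K * H)) := by
  have hH1 : (1 : ℝ) ≤ H := by exact_mod_cast hH
  have hH0 : (0 : ℝ) < H := by linarith
  have hw0 := fun l => (gramMatrix_posDef hH0 τ l).inv.posSemidef.dotProduct_mulVec_self_nonneg
    (visitCount (τ l))
  have hwH : ∀ l, visitCount (τ l) ⬝ᵥ ((gramMatrix (H : ℝ) τ l)⁻¹ *ᵥ visitCount (τ l)) ≤ H := by
    intro l
    refine (quadForm_gramMatrix_inv_le hH0 τ l _).trans ?_
    rw [div_le_iff₀ hH0, ← sq]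
    exact visitCount_dotProduct_self_le (τ l)
  calc _ ≤ ∑ l ∈ Finset.range K, 2 * Real.log (1 + visitCount (τ l) ⬝ᵥ
          ((gramMatrix (H : ℝ) τ l)⁻¹ *ᵥ visitCount (τ l))) :=
        Finset.sum_le_sum fun l _ => div_le_two_mul_log_one_add hH1 (hw0 l) (hwH l)
    _ = 2 * Real.log (∏ l ∈ Finset.range K, (1 + visitCount (τ l) ⬝ᵥ
          ((gramMatrix (H : ℝ) τ l)⁻¹ *ᵥ visitCount (τ l)))) := by
        rw [← Finset.mul_sum, Real.log_prod fun l _ => by linarith [hw0 l]]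
    _ ≤ 2 * Real.log ((1 + K * (H : ℝ) ^ 2 / H) ^ (Fintype.card S * Fintype.card A)) := by
        gcongr
        · exact Finset.prod_pos fun l _ => by linarith [hw0 l]
        · exact prod_one_add_width_le hH0 τ K
    _ = _ := by
        rw [Real.log_pow, show (K : ℝ) * (H : ℝ) ^ 2 / H = K * H by field_simp]
        push_cast
        ring

end Confidence

section Regret

variable {S A : Type*} [Fintype S] [Fintype A] [DecidableEq S] [MeasurableSpace S]
  [MeasurableSpace A] {H : ℕ}

/-- The supremum in `optValue` is attained, the set of policies being finite. -/
lemma FiniteMDP.exists_value_eq_optValue (M : FiniteMDP S A) [Nonempty (DetPolicy S A H)]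
    (s₁ : S) : ∃ π : DetPolicy S A H, M.value π s₁ = M.optValue H s₁ :=
  exists_eq_ciSup_of_finite

/-- With a single state-action pair there is only one policy. -/
lemma regret_eq_zero_of_card_lt_two (M : FiniteMDP S A) (s₁ : ℕ → S)
    (π : ℕ → DetPolicy S A H) (hn : Fintype.card S * Fintype.card A < 2) (K : ℕ) :
    regret M s₁ π K = 0 := by
  have : Nonempty S := ⟨s₁ 0⟩
  have hS : 0 < Fintype.card S := Fintype.card_pos
  have hA : Fintype.card A ≤ 1 := by nlinarith
  have : Subsingleton A := Fintype.card_le_one_iff_subsingleton.1 hA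
  refine Finset.sum_eq_zero fun k _ => ?_
  have : Nonempty (DetPolicy S A H) := ⟨π 0⟩
  obtain ⟨π', hπ'⟩ := M.exists_value_eq_optValue (H := H) (s₁ k)
  rw [← hπ', Subsingleton.elim π' (π k), sub_self]

variable [DecidableEq A] [MeasurableSingletonClass S] [MeasurableSingletonClass A]

/-- Optimism: on the event of the confidence ellipsoid, the regret of an episode is at most twice
the width of the played policy. -/
lemma optValue_sub_value_le (M : FiniteMDP S A) {lam δ : ℝ} (τ : ℕ → Episode S A H) (k : ℕ)
    (s₁ : S) (π : DetPolicy S A H)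
    (hconf : ∀ d : S × A → ℝ, |d ⬝ᵥ lsEstimator lam τ k - d ⬝ᵥ M.meanReward| ≤
      confWidth S A H lam δ k * matNorm (gramMatrix lam τ k)⁻¹ d)
    (hmax : ∀ π' : DetPolicy S A H,
      ofulObjective M lam δ τ k s₁ π' ≤ ofulObjective M lam δ τ k s₁ π) :
    M.optValue H s₁ - M.value π s₁ ≤
      2 * (confWidth S A H lam δ k *
        matNorm (gramMatrix lam τ k)⁻¹ (M.avgOccupancy π s₁)) := by
  have : Nonempty (DetPolicy S A H) := ⟨π⟩
  obtain ⟨π', hπ'⟩ := M.exists_value_eq_optValue (H := H) s₁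
  rw [← hπ', M.value_eq_dotProduct, M.value_eq_dotProduct]
  have h1 := (abs_le.1 (hconf (M.avgOccupancy π' s₁))).1
  have h2 := (abs_le.1 (hconf (M.avgOccupancy π s₁))).2
  have h3 := hmax π'
  simp only [ofulObjective] at h3
  linarith

/-- The regret bound on the intersection of the two high-probability events. -/
lemma regret_le_of_goodEvent (M : FiniteMDP S A) (hH : 1 ≤ H) {δ : ℝ} (hδ : 0 < δ) (hδ1 : δ < 1)
    (s₁ : ℕ → S) (π : ℕ → DetPolicy S A H) (τ : ℕ → Episode S A H)
    (hn : 2 ≤ Fintype.card S * Fintype.card A)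
    (hmax : ∀ k, ∀ π' : DetPolicy S A H,
      ofulObjective M (H : ℝ) δ τ k (s₁ k) π' ≤ ofulObjective M (H : ℝ) δ τ k (s₁ k) (π k))
    (hE1 : ∀ k, ∏ l ∈ Finset.range k, selfNormalizedFactor ((H : ℝ) / 4)
      (gramMatrix (H : ℝ) τ l)⁻¹ (M.noiseSum τ l) (visitCount (τ l)) (M.noise (τ l)) < 10 / δ)
    (hE2 : ∀ k, ∑ l ∈ Finset.range k,
      (M.avgOccupancy (π l) (s₁ l) ⬝ᵥ ((gramMatrix (H : ℝ) τ l)⁻¹ *ᵥ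
          M.avgOccupancy (π l) (s₁ l)) / (2 * H) -
        visitCount (τ l) ⬝ᵥ ((gramMatrix (H : ℝ) τ l)⁻¹ *ᵥ visitCount (τ l)) / H) <
      Real.log (10 / δ))
    {K : ℕ} (hL : 2 ≤ (K : ℝ) * (H : ℝ) / δ) :
    regret M s₁ π K ≤ 30 * ((Fintype.card S : ℝ) * (Fintype.card A : ℝ) * (H : ℝ) * √(K : ℝ) *
      Real.log ((K : ℝ) * (H : ℝ) / δ)) := by
  set n := (Fintype.card S : ℝ) * (Fintype.card A : ℝ) with hn_def
  have hn2 : (2 : ℝ) ≤ n := by rw [hn_def]; exact_mod_cast hn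
  set L := Real.log ((K : ℝ) * (H : ℝ) / δ) with hL_def
  have hH1 : (1 : ℝ) ≤ H := by exact_mod_cast hH
  have hH0 : (0 : ℝ) < H := by linarith
  have hL2 : Real.log 2 ≤ L := Real.log_le_log (by norm_num) hL
  have hl2 := Real.log_two_gt_d9
  have hL0 : 0 ≤ L := by linarith
  have hK0 : K ≠ 0 := by
    rintro rfl
    norm_num at hL
  have hK1 : (1 : ℝ) ≤ K := by exact_mod_cast Nat.one_le_iff_ne_zero.2 hK0
  have hKH : 1 ≤ (K : ℝ) * H := one_le_mul_of_one_le_of_one_le hK1 hH1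
  have hlog10 : Real.log 10 ≤ 4 * Real.log 2 := by
    have : Real.log 10 ≤ Real.log (2 ^ 4) := Real.log_le_log (by norm_num) (by norm_num)
    rw [Real.log_pow] at this
    exact_mod_cast this
  set ρ : ℕ → ℝ := fun l => matNorm (gramMatrix (H : ℝ) τ l)⁻¹ (M.avgOccupancy (π l) (s₁ l))
    with hρ_def
  have hlogδ : Real.log (10 / δ) ≤ 5 * L := by
    have h1 : 10 / δ ≤ 10 * ((K : ℝ) * H / δ) := by
      rw [← mul_div_assoc]
      gcongr
      linarith
    have h2 := Real.log_le_log (by positivity) h1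
    rw [Real.log_mul (by norm_num) (by positivity)] at h2
    linarith
  have hlogKH : Real.log (1 + K * H) ≤ 2 * L := by
    have h1 : 1 + (K : ℝ) * H ≤ ((K : ℝ) * H / δ) ^ 2 := by
      have h2 : (K : ℝ) * H ≤ (K : ℝ) * H / δ := le_div_self (by linarith) hδ hδ1.le
      nlinarith
    have h2 := Real.log_le_log (by positivity) h1
    rw [Real.log_pow] at h2
    push_cast at h2
    exact h2
  -- `9 = 4 + 5`, from the elliptical potential and from `log (10 / δ)`
  have hsq : ∑ l ∈ Finset.range K, ρ l ^ 2 ≤ 18 * (n * H * L) := by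
    have h1 := hE2 K
    have h2 := sum_width_div_le hH τ K
    rw [Finset.sum_sub_distrib, ← Finset.sum_div] at h1
    have h3 : ∑ l ∈ Finset.range K, ρ l ^ 2 = ∑ l ∈ Finset.range K,
        M.avgOccupancy (π l) (s₁ l) ⬝ᵥ ((gramMatrix (H : ℝ) τ l)⁻¹ *ᵥ
          M.avgOccupancy (π l) (s₁ l)) :=
      Finset.sum_congr rfl fun l _ => (gramMatrix_posDef hH0 τ l).inv.posSemidef.matNorm_sq _
    rw [← h3] at h1
    have h4 : 2 * (n * Real.log (1 + K * H)) ≤ 2 * (n * (2 * L)) := by gcongr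
    have h5 : L ≤ n * L := le_mul_of_one_le_left hL0 (by linarith)
    have h6 : (∑ l ∈ Finset.range K, ρ l ^ 2) / (2 * H) ≤ 9 * (n * L) := by linarith
    rw [div_le_iff₀ (by positivity)] at h6
    linarith
  -- Cauchy–Schwarz, with `18 ≤ 5 ^ 2`
  have hsum : ∑ l ∈ Finset.range K, ρ l ≤ 5 * (√(K : ℝ) * √(n * H * L)) := by
    have hx : 0 ≤ n * H * L := by positivity
    have h1 : (∑ l ∈ Finset.range K, ρ l) ^ 2 ≤ K * ∑ l ∈ Finset.range K, ρ l ^ 2 := by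
      simpa using sq_sum_le_card_mul_sum_sq (s := Finset.range K) (f := ρ)
    refine le_of_sq_le_sq ?_ (by positivity)
    calc _ ≤ (K : ℝ) * (18 * (n * H * L)) := h1.trans (by gcongr)
      _ ≤ 25 * (K * (n * H * L)) := by nlinarith [mul_nonneg (by linarith : (0 : ℝ) ≤ K) hx]
      _ = _ := by
        rw [mul_pow, mul_pow, Real.sq_sqrt (by positivity), Real.sq_sqrt hx]; norm_num
  calc regret M s₁ π K
      ≤ ∑ l ∈ Finset.range K, 2 * (3 * √(n * H * L) * ρ l) := by
        refine Finset.sum_le_sum fun l hl => ?_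
        refine (optValue_sub_value_le M τ l (s₁ l) (π l) (fun d =>
          abs_dotProduct_lsEstimator_sub_le M hH hH0 hδ hδ1 hn τ l (hE1 l) d) (hmax l)).trans ?_
        have := confWidth_le (S := S) (A := A) hH hδ (Finset.mem_range.1 hl) hL
        have hρ : 0 ≤ ρ l := matNorm_nonneg _ _
        gcongr
    _ = 6 * √(n * H * L) * ∑ l ∈ Finset.range K, ρ l := by
        rw [Finset.mul_sum]
        exact Finset.sum_congr rfl fun l _ => by ring
    _ ≤ 6 * √(n * H * L) * (5 * (√(K : ℝ) * √(n * H * L))) := by gcongr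
    _ = 30 * √(K : ℝ) * (√(n * H * L) * √(n * H * L)) := by ring
    _ = _ := by
        rw [Real.mul_self_sqrt (by positivity)]
        ring

end Regret

theorem mainTheorem1 :
    ∃ C : ℝ, 0 < C ∧
      ∀ (S A : Type*) [Fintype S] [Fintype A] [DecidableEq S] [DecidableEq A]
        [MeasurableSpace S] [MeasurableSpace A]
        [MeasurableSingletonClass S] [MeasurableSingletonClass A]
        (M : FiniteMDP S A) (H : ℕ) (_ : 1 ≤ H) (δ : ℝ) (_ : 0 < δ) (_ : δ < 1)
        (Ω : Type*) [mΩ : MeasurableSpace Ω] (μ : Measure Ω) [IsProbabilityMeasure μ]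
        (F : Filtration ℕ mΩ) (s₁ : ℕ → Ω → S) (π : ℕ → Ω → DetPolicy S A H)
        (τ : ℕ → Ω → Episode S A H),
        IsInteraction μ F M s₁ π τ → IsOFUL M δ s₁ π τ →
          1 - δ < μ.real {ω | ∀ K : ℕ, 1 ≤ K → 2 ≤ (K : ℝ) * (H : ℝ) / δ →
            regret M (fun k => s₁ k ω) (fun k => π k ω) K ≤
              C * ((Fintype.card S : ℝ) * (Fintype.card A : ℝ) * (H : ℝ) * Real.sqrt (K : ℝ) *
                Real.log ((K : ℝ) * (H : ℝ) / δ))} := by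
  refine ⟨30, by norm_num, ?_⟩
  intro S A _ _ _ _ _ _ _ _ M H hH δ hδ hδ1 Ω mΩ μ _ F s₁ π τ hI hO
  set G : Set Ω := {ω | ∀ K : ℕ, 1 ≤ K → 2 ≤ (K : ℝ) * (H : ℝ) / δ →
    regret M (fun k => s₁ k ω) (fun k => π k ω) K ≤
      30 * ((Fintype.card S : ℝ) * (Fintype.card A : ℝ) * (H : ℝ) * Real.sqrt (K : ℝ) *
        Real.log ((K : ℝ) * (H : ℝ) / δ))} with hG_def
  rcases lt_or_ge (Fintype.card S * Fintype.card A) 2 with hn | hn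
  · have hG : G = Set.univ := by
      refine Set.eq_univ_of_forall fun ω K _ hL => ?_
      rw [regret_eq_zero_of_card_lt_two M _ _ hn]
      have : 0 ≤ Real.log ((K : ℝ) * (H : ℝ) / δ) := Real.log_nonneg (by linarith)
      positivity
    rw [hG, probReal_univ]
    linarith
  have hH0 : (0 : ℝ) < H := by exact_mod_cast hH
  have h10 : 0 < 10 / δ := by positivity
  have hE1 := hI.mul_measure_exists_le_selfNormalized hH hH0 (10 / δ)
  have hE2 := hI.mul_measure_exists_le_widths hH (Real.log (10 / δ))
  rw [Real.exp_log h10] at hE2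
  set E1 : Set Ω := {ω | ∃ k, 10 / δ ≤ ∏ l ∈ Finset.range k,
      selfNormalizedFactor ((H : ℝ) / 4) (gramMatrix (H : ℝ) (fun i => τ i ω) l)⁻¹
        (M.noiseSum (fun i => τ i ω) l) (visitCount (τ l ω)) (M.noise (τ l ω))}
  set E2 : Set Ω := {ω | ∃ k, Real.log (10 / δ) ≤ ∑ l ∈ Finset.range k,
      (M.avgOccupancy (π l ω) (s₁ l ω) ⬝ᵥ ((gramMatrix (H : ℝ) (fun i => τ i ω) l)⁻¹ *ᵥ
          M.avgOccupancy (π l ω) (s₁ l ω)) / (2 * H) -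
        visitCount (τ l ω) ⬝ᵥ ((gramMatrix (H : ℝ) (fun i => τ i ω) l)⁻¹ *ᵥ
          visitCount (τ l ω)) / H)}
  have hreal : ∀ E : Set Ω, ENNReal.ofReal (10 / δ) * μ E ≤ 1 → μ.real E ≤ δ / 10 := by
    intro E hE
    have h1 := ENNReal.toReal_mono ENNReal.one_ne_top hE
    rw [ENNReal.toReal_mul, ENNReal.toReal_ofReal h10.le, ENNReal.toReal_one] at h1
    rw [measureReal_def]
    calc _ = δ / 10 * (10 / δ * (μ E).toReal) := by field_simp
      _ ≤ δ / 10 * 1 := by gcongr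
      _ = _ := mul_one _
  -- only outer measures of the events are used, so that their measurability is not needed
  have hcover : Set.univ ⊆ G ∪ (E1 ∪ E2) := by
    intro ω _
    by_cases h1 : ω ∈ E1
    · exact Or.inr (Or.inl h1)
    by_cases h2 : ω ∈ E2
    · exact Or.inr (Or.inr h2)
    refine Or.inl fun K _ hL => ?_
    exact regret_le_of_goodEvent M hH hδ hδ1 _ _ (fun l => τ l ω) hn (fun k => hO k ω)
      (fun k => not_le.1 fun hk => h1 ⟨k, hk⟩) (fun k => not_le.1 fun hk => h2 ⟨k, hk⟩) hL
  have hμ : (1 : ℝ) ≤ μ.real G + (μ.real E1 + μ.real E2) := by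
    calc (1 : ℝ) = μ.real Set.univ := probReal_univ.symm
      _ ≤ μ.real (G ∪ (E1 ∪ E2)) := measureReal_mono hcover
      _ ≤ μ.real G + μ.real (E1 ∪ E2) := measureReal_union_le _ _
      _ ≤ _ := by gcongr; exact measureReal_union_le _ _
  have := hreal E1 hE1
  have := hreal E2 hE2
  linarith
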